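/- Let $a<c<b$ and let $f:[a,b]\to[a,b]$ be unimodal with turning point $c$: $f$ is continuous, either $f(a)=f(b)=a$ or $f(a)=f(b)=b$, and $f$ is strictly increasing on $[a,c]$ and strictly decreasing on $[c,b]$, or the reverse. Let $\omega(x)$ be the set of accumulation points of the sequence $(f^n(x))_{n\ge 0}$, and for $A\subseteq[a,b]$ let the basin of $A$ be $\{x\in[a,b]:\omega(x)\subseteq A\}$. A closed set $A\subseteq[a,b]$ with $f(A)\subseteq A$ is an attractor if its basin has positive Lebesgue measure and no closed $A'\subsetneq A$ with $f(A')\subseteq A'$ has a basin that differs from the basin of $A$ by a null set. An attracting cycle is a periodic orbit that is an attractor. A wandering interval is a nondegenerate closed interval $J\subseteq[a,b]$ such that the sets $f^k(J)$, $k\ge 0$, are mutually disjoint and $J$ is not contained in the basin of a periodic orbit. For $x,y\in[a,b]$, $x$ is upstream from $y$ if for every $\varepsilon>0$ there are $n\ge 0$ and points $x=x_0,x_1,\dots,x_{n+1}=y$ of $[a,b]$ with $|f(x_i)-x_{i+1}|<\varepsilon$ for $0\le i\le n$; $x$ is chain-recurrent if it is upstream from itself; the nodes of $f$ are the equivalence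 classes of chain-recurrent points under the relation "each is upstream from the other". Assume that $f$ is T-unimodal, that is, $f$ has no wandering intervals, no attracting cycles, and only finitely many nodes. Let $A$ be an attractor of $f$. A backward orbit based at $x$ is a sequence $x_0=x,x_{-1},x_{-2},\dots$ in $[a,b]$ with $f(x_{-i-1})=x_{-i}$ for all $i\ge 0$. 1. If $A$ is the attractor of $f$ (that is, $f$ has no other attractor), then every $x\in A$ has a backward orbit that is dense in $A$, i.e. whose closure contains $A$. 2. If $A$ is a chaotic attractor, then every $x\in A$ has a backward orbit that is contained in $A$ and dense in $A$. Here $A$ is chaotic if it contains a point whose forward orbit is dense in $A$ and it is the union of the intervals of a trapping region, i.e. of finitely many nondegenerate closed intervals $J_1,\dots,J_k\subseteq[a,b]$, $k\ge1$, with pairwise disjoint interiors such that $c\in J_1$ and $f(J_i)\subseteq J_{i+1}$ for $1\le i\le k$, where $J_{k+1}=J_1$. -/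

import Mathlib

open Set Filter Topology MeasureTheory

namespace IntervalDyn

/-- `f` restricts to a continuous self-map of `[a,b]` that is unimodal with turning point `c`
(`c` is a maximum in the first alternative and a minimum in the second). -/
structure IsUnimodal (f : ℝ → ℝ) (a b c : ℝ) : Prop where
  mem : c ∈ Ioo a b
  continuousOn : ContinuousOn f (Icc a b)
  mapsTo : MapsTo f (Icc a b) (Icc a b)
  boundary : (f a = a ∧ f b = a) ∨ (f a = b ∧ f b = b)
  monotone : (StrictMonoOn f (Icc a c) ∧ StrictAntiOn f (Icc c b)) ∨
    (StrictAntiOn f (Icc a c) ∧ StrictMonoOn f (Icc c b))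

/-- The set of accumulation points of the sequence `x, f x, f (f x), …`. -/
def omega (f : ℝ → ℝ) (x : ℝ) : Set ℝ :=
  {y | MapClusterPt y atTop (fun n : ℕ => f^[n] x)}

/-- The basin of attraction of `A` in `[a,b]`. -/
def basin (f : ℝ → ℝ) (a b : ℝ) (A : Set ℝ) : Set ℝ :=
  {x | x ∈ Icc a b ∧ omega f x ⊆ A}

/-- Attractors in the sense of Milnor (with respect to Lebesgue measure). For `A' ⊆ A` the basin
of `A'` is contained in that of `A`, so the two basins differ by a null set exactly when
`basin A \ basin A'` is null. -/
structure IsAttractor (f : ℝ → ℝ) (a b : ℝ) (A : Set ℝ) : Prop where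
  isClosed : IsClosed A
  subset : A ⊆ Icc a b
  invariant : MapsTo f A A
  basin_pos : 0 < volume (basin f a b A)
  minimal : ∀ A' : Set ℝ, A' ⊂ A → IsClosed A' → MapsTo f A' A' →
    volume (basin f a b A \ basin f a b A') ≠ 0

/-- `P` is a periodic orbit of `f` in `[a,b]`. -/
def IsCycle (f : ℝ → ℝ) (a b : ℝ) (P : Set ℝ) : Prop :=
  ∃ p ∈ Icc a b, ∃ n : ℕ, 0 < n ∧ Function.IsPeriodicPt f n p ∧
    P = range (fun i : ℕ => f^[i] p)

/-- An attracting cycle is a periodic orbit that is an attractor. -/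
def IsAttractingCycle (f : ℝ → ℝ) (a b : ℝ) (P : Set ℝ) : Prop :=
  IsCycle f a b P ∧ IsAttractor f a b P

/-- The (nondegenerate, closed) interval `[l,r]` is a wandering interval. -/
structure IsWanderingInterval (f : ℝ → ℝ) (a b l r : ℝ) : Prop where
  lt : l < r
  subset : Icc l r ⊆ Icc a b
  disjoint : ∀ i j : ℕ, i ≠ j → Disjoint (f^[i] '' Icc l r) (f^[j] '' Icc l r)
  not_basin : ¬ ∃ P : Set ℝ, IsCycle f a b P ∧ Icc l r ⊆ basin f a b P

/-- There is an `ε`-chain `x = u 0, u 1, …, u (n + 1) = y` in `[a,b]`. -/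
def HasChain (f : ℝ → ℝ) (a b ε x y : ℝ) : Prop :=
  ∃ (n : ℕ) (u : ℕ → ℝ), u 0 = x ∧ u (n + 1) = y ∧ (∀ i ≤ n + 1, u i ∈ Icc a b) ∧
    ∀ i ≤ n, dist (f (u i)) (u (i + 1)) < ε

/-- `x` is upstream from `y`. -/
def Upstream (f : ℝ → ℝ) (a b x y : ℝ) : Prop :=
  ∀ ε > 0, HasChain f a b ε x y

/-- The set of chain-recurrent points. -/
def chainRecurrent (f : ℝ → ℝ) (a b : ℝ) : Set ℝ :=
  {x | Upstream f a b x x}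

/-- The nodes: classes of chain-recurrent points, two of them being equivalent when each is
upstream from the other. -/
def nodes (f : ℝ → ℝ) (a b : ℝ) : Set (Set ℝ) :=
  {N | ∃ x ∈ chainRecurrent f a b,
    N = {y | y ∈ chainRecurrent f a b ∧ Upstream f a b x y ∧ Upstream f a b y x}}

/-- T-unimodal maps. -/
structure IsTUnimodal (f : ℝ → ℝ) (a b c : ℝ) : Prop where
  unimodal : IsUnimodal f a b c
  no_wandering : ∀ l r : ℝ, ¬ IsWanderingInterval f a b l r
  no_attracting_cycle : ∀ P : Set ℝ, ¬ IsAttractingCycle f a b P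
  finite_nodes : (nodes f a b).Finite

/-- The intervals `[l 0, r 0], …, [l (k-1), r (k-1)]` form a period-`k` trapping region. -/
structure IsTrappingRegion (f : ℝ → ℝ) (a b c : ℝ) (k : ℕ) (l r : ℕ → ℝ) : Prop where
  pos : 0 < k
  lt : ∀ i < k, l i < r i
  subset : ∀ i < k, Icc (l i) (r i) ⊆ Icc a b
  disjoint : ∀ i < k, ∀ j < k, i ≠ j → Disjoint (Ioo (l i) (r i)) (Ioo (l j) (r j))
  mem : c ∈ Icc (l 0) (r 0)
  mapsTo : ∀ i < k, MapsTo f (Icc (l i) (r i)) (Icc (l ((i + 1) % k)) (r ((i + 1) % k)))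

/-- `A` is (the union of the intervals of) a trapping region with a dense orbit. -/
def IsChaotic (f : ℝ → ℝ) (a b c : ℝ) (A : Set ℝ) : Prop :=
  (∃ (k : ℕ) (l r : ℕ → ℝ), IsTrappingRegion f a b c k l r ∧
    A = ⋃ i ∈ Finset.range k, Icc (l i) (r i)) ∧
  ∃ z ∈ A, A ⊆ closure (range (fun n : ℕ => f^[n] z))

/-- `y 0, y 1, y 2, …` is a backward orbit of `f` in `[a,b]` based at `x`; here `y n` stands for
the point with index `-n`. -/
structure IsBackwardOrbit (f : ℝ → ℝ) (a b x : ℝ) (y : ℕ → ℝ) : Prop where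
  zero : y 0 = x
  mem : ∀ n, y n ∈ Icc a b
  step : ∀ n, f (y (n + 1)) = y n

end IntervalDyn

/-! Both parts rest on steering a backward orbit. Let `T` be a compact invariant set with dense
interior in which the forward images of every nonempty open `V ⊆ T` are dense. For a map with one
fold these images cover `T` exactly (`IsTransitiveOn.subset_forwardUnion_of_isOpen`): they form
finitely many cyclically mapped intervals, so only finitely many endpoints could be missed. Such
points would be periodic, and `not_exceptional_right` and `not_exceptional_left` rule them out.
Hence a finite backward orbit in `T` can be prolonged into any prescribed open piece of `T`, and
running through a countable basis makes it dense (`IsTransitiveOn.exists_dense_backward`). A chaotic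
attractor is such a `T`, which gives part 2.

For part 1, the closure of the forward images of any open `V ⊆ [a,b]` contains an attractor,
necessarily `A`. As there are no wandering intervals and no attracting cycles, some image of every
interval contains `c` (`IsTame.exists_turning_mem_image`). Two cases arise. If some open `V` lies in
the forward images of every ball about `c`, the closure of the forward images of `V` is transitive
and contains `A`, so the steering argument applies, although the orbit may leave `A`. Otherwise the
forward images of small balls about `c` form finite cycles of short intervals whose closures cover
`A`. A backward orbit inside `A` visits the closure of each interval of each cycle, so it is
automatically dense (`IsTame.exists_dense_backward_of_small`). -/

namespace IntervalDyn

/-! ### Forward unions -/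

/-- The union of the forward images of `V` under the iterates of `f`. -/
def forwardUnion {α : Type*} (f : α → α) (V : Set α) : Set α := ⋃ n : ℕ, f^[n] '' V

section Generic

variable {α : Type*} {f : α → α}

theorem mem_forwardUnion {V : Set α} {x : α} :
    x ∈ forwardUnion f V ↔ ∃ n : ℕ, ∃ v ∈ V, f^[n] v = x := by
  simp [forwardUnion]

theorem subset_forwardUnion {V : Set α} : V ⊆ forwardUnion f V :=
  fun x hx => mem_forwardUnion.2 ⟨0, x, hx, rfl⟩

theorem mapsTo_forwardUnion {V : Set α} : MapsTo f (forwardUnion f V) (forwardUnion f V) := by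
  intro x hx
  obtain ⟨n, v, hv, rfl⟩ := mem_forwardUnion.1 hx
  exact mem_forwardUnion.2 ⟨n + 1, v, hv, Function.iterate_succ_apply' f n v⟩

theorem forwardUnion_subset {V T : Set α} (hV : V ⊆ T) (hT : MapsTo f T T) :
    forwardUnion f V ⊆ T := by
  intro x hx
  obtain ⟨n, v, hv, rfl⟩ := mem_forwardUnion.1 hx
  exact hT.iterate n (hV hv)

theorem forwardUnion_subset_forwardUnion {V V' : Set α} (h : V ⊆ forwardUnion f V') :
    forwardUnion f V ⊆ forwardUnion f V' :=
  forwardUnion_subset h mapsTo_forwardUnion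

theorem iterate_eq_iterate_mod (f : α → α) (M n : ℕ) (x : α) :
    f^[n] x = f^[n % M] ((f^[M])^[n / M] x) := by
  rw [← Function.iterate_mul, ← Function.iterate_add_apply, Nat.mod_add_div]

theorem iterate_eq_iterate_div (f : α → α) (M n : ℕ) (x : α) :
    f^[n] x = (f^[M])^[n / M] (f^[n % M] x) := by
  rw [← Function.iterate_mul, ← Function.iterate_add_apply, Nat.div_add_mod]

variable [TopologicalSpace α]

theorem exists_nhds_iterate_ne [T2Space α] (hf : Continuous f) {M : ℕ} {q t : α}
    (h : ∀ i < M, f^[i] q ≠ t) :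
    ∃ U ∈ 𝓝 q, ∃ Q ∈ 𝓝 t, ∀ y ∈ U, ∀ s ∈ Q, ∀ i < M, f^[i] y ≠ s := by
  have key : ∀ᶠ p : α × α in 𝓝 q ×ˢ 𝓝 t, ∀ i ∈ Finset.range M, f^[i] p.1 ≠ p.2 := by
    rw [Filter.eventually_all_finset]
    intro i hi
    rw [← nhds_prod_eq]
    have hc : ContinuousAt (fun p : α × α => (f^[i] p.1, p.2)) (q, t) :=
      (((hf.iterate i).comp continuous_fst).prodMk continuous_snd).continuousAt
    exact hc.eventually ((isClosed_diagonal.isOpen_compl).mem_nhds (h i (Finset.mem_range.1 hi)))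
  obtain ⟨U, hU, Q, hQ, hUQ⟩ := Filter.eventually_prod_iff.1 key
  exact ⟨{y | U y}, hU, {s | Q s}, hQ, fun y hy s hs i hi => hUQ hy hs i (Finset.mem_range.2 hi)⟩

/-- By `f^[M]`-invariance of `D`, every iterate of a point of `D` is one of the first `M` iterates
of another point of `D`, so control of finitely many iterates suffices. -/
theorem notMem_closure_forwardUnion {M : ℕ} (hM : 0 < M) {D Q : Set α} {t : α} (hQ : Q ∈ 𝓝 t)
    (hD : MapsTo f^[M] D D) (h : ∀ y ∈ D, ∀ s ∈ Q, ∀ i < M, f^[i] y ≠ s) :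
    t ∉ closure (forwardUnion f D) := by
  intro ht
  obtain ⟨s, hsQ, hs⟩ := mem_closure_iff_nhds.1 ht Q hQ
  obtain ⟨n, v, hv, rfl⟩ := mem_forwardUnion.1 hs
  rw [iterate_eq_iterate_mod f M] at hsQ
  exact h _ (hD.iterate _ hv) _ hsQ _ (Nat.mod_lt _ hM) rfl

/-- `f` is topologically transitive on the forward invariant set `T`, in terms of the open
subsets of the ambient space which are contained in `T`. -/
structure IsTransitiveOn (f : α → α) (T : Set α) : Prop where
  isCompact : IsCompact T
  mapsTo : MapsTo f T T
  subset_closure_interior : T ⊆ closure (interior T)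
  subset_closure_forwardUnion : ∀ V : Set α, IsOpen V → V.Nonempty → V ⊆ T →
    T ⊆ closure (forwardUnion f V)

end Generic

/-- Near `q` on the right, `f^[M]` either traps or repels. Trapping would confine an open set near
the orbit of `q`, away from `t₀`. Repelling makes a small interval to the right of `q` inaccessible
from the rest of `T`, so a neighbourhood of `v` never reaches it. Both contradict transitivity. The
order is left abstract so that the mirror image follows by passing to `ℝᵒᵈ`. -/
theorem IsTransitiveOn.not_exceptional_right {α : Type*} [ConditionallyCompleteLinearOrder α]
    [TopologicalSpace α] [OrderTopology α] [DenselyOrdered α] {f : α → α} (hf : Continuous f)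
    {T : Set α} (hT : IsTransitiveOn f T) {M : ℕ} (hM : 0 < M) {q d v t₀ : α} (hqd : q < d)
    (hqdT : Ioo q d ⊆ T) (hq : f^[M] q = q) (hgt : ∀ t ∈ T, q < t → q < f^[M] t)
    (hle : ∀ t ∈ T, t ≤ q → f^[M] t ≤ q) (hinj : InjOn f^[M] (Icc q d))
    (hv : v ∈ interior T) (hvq : ∀ i < M, f^[i] v ≠ q)
    (ht₀ : t₀ ∈ T) (hqt : ∀ i < M, f^[i] q ≠ t₀) : False := by
  set G := f^[M] with hG
  have hGc : Continuous G := hf.iterate M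
  obtain ⟨U, hU, Q, hQ, hUQ⟩ := exists_nhds_iterate_ne hf hqt
  obtain ⟨d₀, hd₀, hd₀U⟩ := exists_Ico_subset_of_mem_nhds hU ⟨d, hqd⟩
  obtain ⟨d₁, hqd₁, hd₁d⟩ := exists_between (lt_min hqd hd₀)
  have hd₁d' : d₁ < d := hd₁d.trans_le (min_le_left _ _)
  have hd₁d₀ : d₁ < d₀ := hd₁d.trans_le (min_le_right _ _)
  have hmono : StrictMonoOn G (Icc q d₁) := by
    have hd₁T : d₁ ∈ T := hqdT ⟨hqd₁, hd₁d'⟩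
    refine ContinuousOn.strictMonoOn_of_injOn_Icc hqd₁.le ?_ hGc.continuousOn
      (hinj.mono (Icc_subset_Icc_right hd₁d'.le))
    rw [hq]
    exact (hgt _ hd₁T hqd₁).le
  have hexp : ∀ y ∈ Ioo q d₁, y < G y := by
    intro y hy
    by_contra! hGy
    have hyT : Ioo q y ⊆ T := fun t ht => hqdT ⟨ht.1, ht.2.trans (hy.2.trans hd₁d')⟩
    have hmaps : MapsTo G (Ioo q y) (Ioo q y) := fun t ht =>
      ⟨hgt t (hyT ht) ht.1, (hmono ⟨ht.1.le, (ht.2.trans hy.2).le⟩ ⟨hy.1.le, hy.2.le⟩ ht.2).trans_le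
        hGy⟩
    refine notMem_closure_forwardUnion hM hQ hmaps (fun z hz => hUQ z (hd₀U
      ⟨hz.1.le, hz.2.trans (hy.2.trans hd₁d₀)⟩)) ?_
    exact hT.subset_closure_forwardUnion _ isOpen_Ioo (nonempty_Ioo.2 hy.1) hyT ht₀
  -- By compactness, points of `T` beyond `d₁` are sent a definite distance to the right of `q`.
  obtain ⟨e, hqe, hed₁, he⟩ : ∃ e, q < e ∧ e ≤ d₁ ∧ ∀ t ∈ T, d₁ ≤ t → e ≤ G t := by
    rcases (T ∩ Ici d₁).eq_empty_or_nonempty with h | h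
    · exact ⟨d₁, hqd₁, le_rfl, fun t ht htd => absurd (show t ∈ T ∩ Ici d₁ from ⟨ht, htd⟩)
        (by simp [h])⟩
    · obtain ⟨m, hm, hmin⟩ := (hT.isCompact.inter_right isClosed_Ici).exists_isMinOn h
        hGc.continuousOn
      refine ⟨min (G m) d₁, lt_min (hgt m hm.1 (hqd₁.trans_le hm.2)) hqd₁, min_le_right _ _,
        fun t ht htd => (min_le_left _ _).trans (hmin ⟨ht, htd⟩)⟩
  obtain ⟨U', hU', Q', hQ', hUQ'⟩ := exists_nhds_iterate_ne hf hvq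
  obtain ⟨e₀, he₀, he₀Q⟩ := exists_Ico_subset_of_mem_nhds hQ' ⟨d, hqd⟩
  set e' := min e e₀ with he'
  have hqe' : q < e' := lt_min hqe he₀
  -- No point enters `(q, e')` from outside: points left of `q` stay there, points in `(q, d₁)` move
  -- right, and those beyond `d₁` land at or past `e`.
  have hinv : MapsTo G (T \ Ioo q e') (T \ Ioo q e') := by
    rintro t ⟨htT, ht⟩
    refine ⟨hT.mapsTo.iterate M htT, fun hGt => ?_⟩
    have htq : q < t := by
      by_contra! htq
      exact absurd hGt.1 (not_lt.2 (hle t htT htq))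
    rcases lt_or_ge t d₁ with htd | htd
    · exact ht ⟨htq, (hexp t ⟨htq, htd⟩).trans hGt.2⟩
    · exact absurd (he t htT htd) (not_le.2 (hGt.2.trans_le (min_le_left _ _)))
  have hDne : (interior T ∩ interior U').Nonempty :=
    ⟨v, hv, mem_interior_iff_mem_nhds.2 hU'⟩
  have hDT : interior T ∩ interior U' ⊆ T := inter_subset_left.trans interior_subset
  obtain ⟨s, hs⟩ := nonempty_Ioo.2 hqe'
  have hsT : s ∈ T := hqdT ⟨hs.1, hs.2.trans_le
    ((min_le_left _ _).trans (hed₁.trans hd₁d'.le))⟩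
  obtain ⟨w, hw, hwD⟩ := mem_closure_iff.1 (hT.subset_closure_forwardUnion _
    (isOpen_interior.inter isOpen_interior) hDne hDT hsT) _ isOpen_Ioo hs
  obtain ⟨n, u, hu, rfl⟩ := mem_forwardUnion.1 hwD
  rw [iterate_eq_iterate_div f M] at hw
  refine (hinv.iterate (n / M) (x := f^[n % M] u) ⟨hT.mapsTo.iterate _ (hDT hu), fun h => ?_⟩).2 hw
  exact hUQ' u (interior_subset hu.2) _ (he₀Q ⟨h.1.le, h.2.trans_le (min_le_right _ _)⟩) _
    (Nat.mod_lt _ hM) rfl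

theorem IsTransitiveOn.not_exceptional_left {f : ℝ → ℝ} (hf : Continuous f)
    {T : Set ℝ} (hT : IsTransitiveOn f T) {M : ℕ} (hM : 0 < M) {q d v t₀ : ℝ} (hqd : d < q)
    (hqdT : Ioo d q ⊆ T) (hq : f^[M] q = q) (hgt : ∀ t ∈ T, t < q → f^[M] t < q)
    (hle : ∀ t ∈ T, q ≤ t → q ≤ f^[M] t) (hinj : InjOn f^[M] (Icc d q))
    (hv : v ∈ interior T) (hvq : ∀ i < M, f^[i] v ≠ q)
    (ht₀ : t₀ ∈ T) (hqt : ∀ i < M, f^[i] q ≠ t₀) : False := by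
  have hT' : @IsTransitiveOn ℝᵒᵈ _ f T := ⟨hT.1, hT.2, hT.3, hT.4⟩
  refine @IsTransitiveOn.not_exceptional_right ℝᵒᵈ _ _ _ _ f hf T hT' M hM q d v t₀ hqd
    (fun x hx => hqdT ⟨hx.2, hx.1⟩) hq hgt hle (fun x hx y hy h => hinj ⟨hx.2, hx.1⟩ ⟨hy.2, hy.1⟩ h)
    hv hvq ht₀ hqt

/-! ### Maps which are injective on both sides of a turning point -/

/-- `f` is continuous on the line and injective on either side of `c`. -/
structure IsFold (f : ℝ → ℝ) (c : ℝ) : Prop where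
  continuous : Continuous f
  injOn_Iic : InjOn f (Iic c)
  injOn_Ici : InjOn f (Ici c)

section Fold

variable {f : ℝ → ℝ} {c : ℝ}

theorem IsFold.injOn_iterate (hf : IsFold f c) {I : Set ℝ} {n : ℕ}
    (h : ∀ i < n, f^[i] '' I ⊆ Iic c ∨ f^[i] '' I ⊆ Ici c) : InjOn f^[n] I := by
  induction n with
  | zero => exact fun x _ y _ hxy => hxy
  | succ n ih =>
    rw [Function.iterate_succ']
    have hn := ih fun i hi => h i (hi.trans n.lt_succ_self)
    rcases h n n.lt_succ_self with h' | h'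
    · exact hf.injOn_Iic.comp hn (mapsTo_iff_image_subset.2 h')
    · exact hf.injOn_Ici.comp hn (mapsTo_iff_image_subset.2 h')

theorem subset_Iio_or_subset_Ioi_of_notMem {S : Set ℝ} (hS : IsPreconnected S) {x : ℝ}
    (hx : x ∉ S) : S ⊆ Iio x ∨ S ⊆ Ioi x := by
  by_contra! h
  obtain ⟨⟨s, hs, hsx⟩, t, ht, htx⟩ := And.imp not_subset.1 not_subset.1 h
  exact hx (hS.ordConnected.out ht hs ⟨not_lt.1 htx, not_lt.1 hsx⟩)

theorem IsFold.injOn_iterate_of_notMem (hf : IsFold f c) {I : Set ℝ} (hI : IsPreconnected I)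
    {n : ℕ} (h : ∀ i < n, c ∉ f^[i] '' I) : InjOn f^[n] I :=
  hf.injOn_iterate fun i hi =>
    (subset_Iio_or_subset_Ioi_of_notMem
    (hI.image _ (hf.continuous.iterate i).continuousOn) (h i hi)).imp
      (·.trans Iio_subset_Iic_self) (·.trans Ioi_subset_Ici_self)

theorem IsFold.finite_iterate_preimage (hf : IsFold f c) (x : ℝ) (n : ℕ) :
    (f^[n] ⁻¹' {x}).Finite := by
  induction n with
  | zero => simp
  | succ n ih =>
    rw [Function.iterate_succ, preimage_comp]
    set S := f^[n] ⁻¹' {x}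
    have h1 : (f ⁻¹' S ∩ Iic c).Finite := .of_finite_image
      (ih.subset (image_subset_iff.2 inter_subset_left)) (hf.injOn_Iic.mono inter_subset_right)
    have h2 : (f ⁻¹' S ∩ Ici c).Finite := .of_finite_image
      (ih.subset (image_subset_iff.2 inter_subset_left)) (hf.injOn_Ici.mono inter_subset_right)
    refine (h1.union h2).subset fun y hy => ?_
    exact (le_total y c).imp (fun h => ⟨hy, h⟩) (fun h => ⟨hy, h⟩)

theorem IsFold.injOn_iterate_Icc (hf : IsFold f c) {u v : ℝ} {n : ℕ} (huv : u < v)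
    (h : ∀ i < n, ∀ x ∈ Ioo u v, f^[i] x ≠ c) : InjOn f^[n] (Icc u v) := by
  refine hf.injOn_iterate fun i hi => ?_
  have hc := hf.continuous.iterate i
  rw [← closure_Ioo huv.ne]
  have hI : c ∉ f^[i] '' Ioo u v := by
    rintro ⟨x, hx, hxc⟩
    exact h i hi x hx hxc
  refine (subset_Iio_or_subset_Ioi_of_notMem
    (isPreconnected_Ioo.image _ hc.continuousOn) hI).imp
    (fun h' => ?_) (fun h' => ?_)
  · exact (image_closure_subset_closure_image hc).trans
      (closure_minimal (h'.trans Iio_subset_Iic_self) isClosed_Iic)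
  · exact (image_closure_subset_closure_image hc).trans
      (closure_minimal (h'.trans Ioi_subset_Ici_self) isClosed_Ici)

theorem IsFold.exists_nhds_iterate_ne (hf : IsFold f c) (q : ℝ) (n : ℕ) :
    ∃ U ∈ 𝓝 q, ∀ i < n, ∀ x ∈ U, x ≠ q → f^[i] x ≠ c := by
  have hfin : (⋃ i ∈ Finset.range n, f^[i] ⁻¹' {c}).Finite :=
    (Finset.range n).finite_toSet.biUnion fun i _ => hf.finite_iterate_preimage c i
  refine ⟨_, (hfin.subset (sdiff_subset (t := {q}))).isClosed.isOpen_compl.mem_nhds (by simp),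
    fun i hi x hx hxq hxc => hx ⟨?_, hxq⟩⟩
  exact mem_biUnion (Finset.mem_range.2 hi) hxc

theorem IsFold.exists_injOn_right (hf : IsFold f c) {q d : ℝ} (hqd : q < d) (n : ℕ) :
    ∃ e, q < e ∧ e ≤ d ∧ InjOn f^[n] (Icc q e) := by
  obtain ⟨U, hU, h⟩ := hf.exists_nhds_iterate_ne q n
  obtain ⟨e, he, heU⟩ := exists_Ico_subset_of_mem_nhds hU ⟨d, hqd⟩
  refine ⟨min e d, lt_min he hqd, min_le_right _ _, hf.injOn_iterate_Icc (lt_min he hqd)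
    fun i hi x hx => h i hi x (heU ⟨hx.1.le, hx.2.trans_le (min_le_left _ _)⟩) hx.1.ne'⟩

theorem IsFold.exists_injOn_left (hf : IsFold f c) {q d : ℝ} (hqd : d < q) (n : ℕ) :
    ∃ e, e < q ∧ d ≤ e ∧ InjOn f^[n] (Icc e q) := by
  obtain ⟨U, hU, h⟩ := hf.exists_nhds_iterate_ne q n
  obtain ⟨e, he, heU⟩ := exists_Ioc_subset_of_mem_nhds hU ⟨d, hqd⟩
  refine ⟨max e d, max_lt he hqd, le_max_right _ _, hf.injOn_iterate_Icc (max_lt he hqd)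
    fun i hi x hx => h i hi x (heU ⟨(le_max_left _ _).trans_lt hx.1, hx.2.le⟩) hx.2.ne⟩

theorem exists_Ioo_subset_of_isOpen {V : Set ℝ} (hV : IsOpen V) {x : ℝ} (hx : x ∈ V) :
    ∃ u v, u < x ∧ x < v ∧ Ioo u v ⊆ V := by
  obtain ⟨u, v, hx', h⟩ := mem_nhds_iff_exists_Ioo_subset.1 (hV.mem_nhds hx)
  exact ⟨u, v, hx'.1, hx'.2, h⟩

theorem IsFold.interior_image_nonempty (hf : IsFold f c) {V : Set ℝ} (hV : IsOpen V)
    (hne : V.Nonempty) : (interior (f '' V)).Nonempty := by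
  obtain ⟨x, hx⟩ := hne
  obtain ⟨u, v, hux, hxv, huv⟩ := exists_Ioo_subset_of_isOpen hV hx
  obtain ⟨y, hxy, hyv⟩ := exists_between hxv
  obtain ⟨z, hxz, hzy, hinj⟩ := hf.exists_injOn_right hxy 1
  have hne : f x ≠ f z := fun h => hxz.ne (hinj (left_mem_Icc.2 hxz.le) (right_mem_Icc.2 hxz.le) h)
  have hsub : uIcc (f x) (f z) ⊆ f '' V := by
    refine (intermediate_value_uIcc hf.continuous.continuousOn).trans (image_mono ?_)
    rw [uIcc_of_le hxz.le]
    exact fun t ht => huv ⟨hux.trans_le ht.1, ht.2.trans_lt (hzy.trans_lt hyv)⟩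
  refine Set.Nonempty.mono (interior_mono hsub) ?_
  rw [uIcc, interior_Icc]
  exact nonempty_Ioo.2 (by simpa using hne.symm)

theorem IsFold.interior_iterate_image_nonempty (hf : IsFold f c) {V : Set ℝ} (hV : IsOpen V)
    (hne : V.Nonempty) (n : ℕ) : (interior (f^[n] '' V)).Nonempty := by
  induction n with
  | zero => simpa [hV.interior_eq] using hne
  | succ n ih =>
    rw [Function.iterate_succ', image_comp]
    exact (hf.interior_image_nonempty isOpen_interior ih).mono
      (interior_mono (image_mono interior_subset))

/-- The union of the `f^[p]`-iterates of `V` is connected because consecutive images overlap. The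
forward images of `V` are thereby organised into at most `p` connected pieces. -/
theorem exists_preconnected_mapsTo (hf : Continuous f) {V : Set ℝ} (hV : IsPreconnected V) {p : ℕ}
    (h : (V ∩ f^[p] '' V).Nonempty) :
    ∃ C, IsPreconnected C ∧ V ⊆ C ∧ MapsTo f^[p] C C ∧ C ⊆ forwardUnion f V := by
  refine ⟨forwardUnion f^[p] V, ?_, subset_forwardUnion, mapsTo_forwardUnion, ?_⟩
  · refine IsPreconnected.iUnion_of_chain
      (fun n => hV.image _ ((hf.iterate p).iterate n).continuousOn) fun n => ?_
    change (_ ∩ (f^[p])^[n + 1] '' V).Nonempty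
    rw [Function.iterate_succ, image_comp]
    exact (h.image ((f^[p])^[n])).mono (image_inter_subset _ _ _)
  · intro x hx
    obtain ⟨n, v, hv, rfl⟩ := mem_forwardUnion.1 hx
    exact mem_forwardUnion.2 ⟨p * n, v, hv, by rw [Function.iterate_mul]⟩

theorem exists_mem_iterate_image {V C : Set ℝ} {p : ℕ} (hp : 0 < p) (hVC : V ⊆ C)
    (hC : MapsTo f^[p] C C) {x : ℝ} (hx : x ∈ forwardUnion f V) : ∃ s < p, x ∈ f^[s] '' C := by
  obtain ⟨n, v, hv, rfl⟩ := mem_forwardUnion.1 hx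
  rw [iterate_eq_iterate_mod f p]
  exact ⟨n % p, Nat.mod_lt _ hp, mem_image_of_mem _ (hC.iterate _ (hVC hv))⟩

theorem exists_mem_closure_iterate_image {V C : Set ℝ} {p : ℕ} (hp : 0 < p) (hVC : V ⊆ C)
    (hC : MapsTo f^[p] C C) {x : ℝ} (hx : x ∈ closure (forwardUnion f V)) :
    ∃ s < p, x ∈ closure (f^[s] '' C) := by
  have h : forwardUnion f V ⊆ ⋃ s ∈ Finset.range p, f^[s] '' C := fun y hy => by
    simpa using exists_mem_iterate_image hp hVC hC hy
  have := closure_mono h hx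
  rw [Finset.closure_biUnion] at this
  simpa using this

theorem finite_closure_diff_of_isPreconnected {S : Set ℝ} (hS : IsPreconnected S) :
    (closure S \ S).Finite := by
  have h : closure S \ S ⊆ {x | IsLUB S x} ∪ {x | IsGLB S x} := by
    rintro x ⟨hx, hxS⟩
    refine (subset_Iio_or_subset_Ioi_of_notMem hS hxS).imp (fun h => ?_) (fun h => ?_)
    · exact isLUB_of_mem_closure (fun y hy => (h hy).le) hx
    · exact isGLB_of_mem_closure (fun y hy => (h hy).le) hx
  refine Set.Finite.subset (Set.Finite.union ?_ ?_) h
  · exact Set.Subsingleton.finite fun x hx y hy => IsLUB.unique hx hy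
  · exact Set.Subsingleton.finite fun x hx y hy => IsGLB.unique hx hy

/-- Counting forces `f` to permute `E`, and `N` is the order of that permutation. -/
theorem exists_iterate_eq_self_of_subset_image {α : Type*} {f : α → α} {E : Set α} (hE : E.Finite)
    (h : E ⊆ f '' E) : MapsTo f E E ∧ ∃ N, 0 < N ∧ ∀ x ∈ E, f^[N] x = x := by
  have himg : E = f '' E :=
    Set.eq_of_subset_of_ncard_le h (Set.ncard_image_le hE) (hE.image f)
  have hinj : InjOn f E := Set.injOn_of_ncard_image_eq (by rw [← himg]) hE
  have hmaps : MapsTo f E E := mapsTo_iff_image_subset.2 himg.ge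
  have := hE.to_subtype
  let e : Equiv.Perm E := Equiv.ofBijective (hmaps.restrict f E E)
    (Finite.injective_iff_bijective.1 (hmaps.restrict_inj.2 hinj))
  refine ⟨hmaps, orderOf e, orderOf_pos e, fun x hx => ?_⟩
  have h1 : (⇑e)^[orderOf e] = id := by
    rw [Equiv.Perm.iterate_eq_pow, pow_orderOf_eq_one, Equiv.Perm.coe_one]
  have h2 : ∀ n, (((⇑e)^[n] ⟨x, hx⟩ : E) : α) = f^[n] x := by
    intro n
    induction n with
    | zero => rfl
    | succ n ih => rw [Function.iterate_succ_apply', Function.iterate_succ_apply', ← ih]; rfl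
  rw [← h2, h1]; rfl

/-! ### Transitive sets of a fold map -/

variable {T : Set ℝ}

theorem IsTransitiveOn.subset_closure_forwardUnion_image (hf : IsFold f c) (hT : IsTransitiveOn f T) {V : Set ℝ}
    (hV : IsOpen V) (hne : V.Nonempty) (hVT : V ⊆ T) :
    T ⊆ closure (forwardUnion f (f '' V)) := by
  refine (hT.subset_closure_forwardUnion _ isOpen_interior (hf.interior_image_nonempty hV hne)
    ?_).trans (closure_mono (forwardUnion_subset_forwardUnion
      (interior_subset.trans subset_forwardUnion)))
  exact interior_subset.trans ((image_mono hVT).trans hT.mapsTo.image_subset)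

theorem IsTransitiveOn.subset_image (hf : IsFold f c) (hT : IsTransitiveOn f T) {V : Set ℝ}
    (hV : IsOpen V) (hne : V.Nonempty) (hVT : V ⊆ T) : T ⊆ f '' T := by
  refine (hT.subset_closure_forwardUnion_image hf hV hne hVT).trans
    (closure_minimal ?_ (hT.isCompact.image hf.continuous).isClosed)
  exact forwardUnion_subset (image_mono hVT) fun x hx => mem_image_of_mem f
    (hT.mapsTo.image_subset hx)

/-- A topologically transitive set of a one-dimensional map with a single turning point is
covered by the forward images of any of its nonempty open subsets. -/
theorem IsTransitiveOn.subset_forwardUnion_of_isOpen (hf : IsFold f c) (hT : IsTransitiveOn f T) {V : Set ℝ}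
    (hV : IsOpen V) (hne : V.Nonempty) (hVT : V ⊆ T) : T ⊆ forwardUnion f V := by
  obtain ⟨x, hx⟩ := hne
  obtain ⟨u, v, hux, hxv, huv⟩ := exists_Ioo_subset_of_isOpen hV hx
  set I := Ioo u v
  have hxI : x ∈ I := ⟨hux, hxv⟩
  have hIT : I ⊆ T := huv.trans hVT
  refine Subset.trans ?_ (forwardUnion_subset_forwardUnion (huv.trans subset_forwardUnion))
  -- Density is used for the images of `f '' I` rather than of `I`, so that the return time `n + 1`
  -- is positive.
  obtain ⟨w, hwI, hw⟩ := mem_closure_iff.1 (hT.subset_closure_forwardUnion_image hf isOpen_Ioo ⟨x, hxI⟩ hIT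
    (hIT hxI)) I isOpen_Ioo hxI
  obtain ⟨n, z, ⟨y, hy, rfl⟩, rfl⟩ := mem_forwardUnion.1 hw
  have hp : 0 < n + 1 := n.succ_pos
  obtain ⟨C, hC, hIC, hCmaps, hCI⟩ := exists_preconnected_mapsTo hf.continuous
    (isPreconnected_Ioo (a := u) (b := v)) (p := n + 1)
    ⟨_, hwI, ⟨y, hy, Function.iterate_succ_apply f n y⟩⟩
  set p := n + 1
  set W := forwardUnion f I with hW
  have hWT : W ⊆ T := forwardUnion_subset hIT hT.mapsTo
  have hTW : T ⊆ closure W := hT.subset_closure_forwardUnion _ isOpen_Ioo ⟨x, hxI⟩ hIT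
  have hSW : ∀ s, f^[s] '' C ⊆ W := by
    rintro s _ ⟨z, hz, rfl⟩
    exact mapsTo_forwardUnion.iterate s (hCI hz)
  have hSpre : ∀ s, IsPreconnected (f^[s] '' C) := fun s =>
    hC.image _ (hf.continuous.iterate s).continuousOn
  have hSmaps : ∀ s, MapsTo f^[p] (f^[s] '' C) (f^[s] '' C) := by
    rintro s _ ⟨z, hz, rfl⟩
    refine ⟨f^[p] z, hCmaps hz, ?_⟩
    rw [← Function.iterate_add_apply, ← Function.iterate_add_apply, add_comm]
  -- A missed point is in the closure of one of the `p` connected pieces but not in the piece, hence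
  -- is one of its endpoints.
  have hEfin : (T \ W).Finite := by
    refine ((Finset.range p).finite_toSet.biUnion fun s _ =>
      finite_closure_diff_of_isPreconnected (hSpre s)).subset ?_
    rintro t ⟨htT, htW⟩
    obtain ⟨s, hs, hts⟩ := exists_mem_closure_iterate_image hp hIC hCmaps (hTW htT)
    exact mem_biUnion (Finset.mem_coe.2 (Finset.mem_range.2 hs)) ⟨hts, fun h => htW (hSW s h)⟩
  have hEimg : T \ W ⊆ f '' (T \ W) := by
    rintro t ⟨htT, htW⟩
    obtain ⟨t', ht', rfl⟩ := hT.subset_image hf isOpen_Ioo ⟨x, hxI⟩ hIT htT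
    exact ⟨t', ⟨ht', fun h => htW (mapsTo_forwardUnion h)⟩, rfl⟩
  obtain ⟨hEmaps, N, hN, hEN⟩ := exists_iterate_eq_self_of_subset_image hEfin hEimg
  have hG : ∀ t ∈ T \ W, f^[p * N] t = t := by
    intro t ht
    rw [mul_comm, Function.iterate_mul]
    exact Function.iterate_fixed (hEN t ht) p
  have hGS : ∀ s, MapsTo f^[p * N] (f^[s] '' C) (f^[s] '' C) := by
    intro s
    rw [Function.iterate_mul]
    exact (hSmaps s).iterate N
  have hM : 0 < p * N := Nat.mul_pos hp hN
  intro q hqT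
  by_contra hqW
  have hqE : q ∈ T \ W := ⟨hqT, hqW⟩
  -- A piece of `W` is an interval invariant under `f^[p * N]` that omits `q`, so its points cannot
  -- cross `q`; the remaining points of `T` are fixed.
  have hgt : ∀ t ∈ T, q < t → q < f^[p * N] t := by
    intro t ht hqt
    by_cases htW : t ∈ W
    · obtain ⟨s, -, hts⟩ := exists_mem_iterate_image hp hIC hCmaps htW
      by_contra! h
      exact hqW (hSW s ((hSpre s).ordConnected.out (hGS s hts) hts ⟨h, hqt.le⟩))
    · rwa [hG t ⟨ht, htW⟩]
  have hlt : ∀ t ∈ T, t < q → f^[p * N] t < q := by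
    intro t ht hqt
    by_cases htW : t ∈ W
    · obtain ⟨s, -, hts⟩ := exists_mem_iterate_image hp hIC hCmaps htW
      by_contra! h
      exact hqW (hSW s ((hSpre s).ordConnected.out hts (hGS s hts) ⟨hqt.le, h⟩))
    · rwa [hG t ⟨ht, htW⟩]
  have hxint : x ∈ interior T := interior_maximal hIT isOpen_Ioo hxI
  have hxW : x ∈ W := subset_forwardUnion hxI
  have hxq : ∀ i < p * N, f^[i] x ≠ q := fun i _ h =>
    hqW (h ▸ mapsTo_forwardUnion.iterate i hxW)
  have hqx : ∀ i < p * N, f^[i] q ≠ x := fun i _ h => (hEmaps.iterate i hqE).2 (h ▸ hxW)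
  obtain ⟨s, -, hqs⟩ := exists_mem_closure_iterate_image hp hIC hCmaps (hTW hqT)
  obtain ⟨z, hz⟩ : (f^[s] '' C).Nonempty := ⟨_, mem_image_of_mem _ (hIC hxI)⟩
  rcases lt_trichotomy q z with hqz | rfl | hzq
  · have hsub : Ioo q z ⊆ T := by
      rintro t ⟨hqt, htz⟩
      obtain ⟨s', hs't, hs'⟩ := mem_closure_iff.1 hqs (Iio t) isOpen_Iio hqt
      exact hWT (hSW s ((hSpre s).ordConnected.out hs' hz ⟨le_of_lt hs't, htz.le⟩))
    obtain ⟨e, hqe, hez, hinj⟩ := hf.exists_injOn_right hqz (p * N)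
    refine hT.not_exceptional_right hf.continuous hM hqe ((Ioo_subset_Ioo_right hez).trans hsub)
      (hG q hqE) hgt (fun t ht htq => ?_) hinj hxint hxq (hIT hxI) hqx
    rcases htq.lt_or_eq with h | rfl
    · exact (hlt t ht h).le
    · exact (hG t hqE).le
  · exact hqW (hSW s hz)
  · have hsub : Ioo z q ⊆ T := by
      rintro t ⟨hzt, htq⟩
      obtain ⟨s', hs't, hs'⟩ := mem_closure_iff.1 hqs (Ioi t) isOpen_Ioi htq
      exact hWT (hSW s ((hSpre s).ordConnected.out hz hs' ⟨hzt.le, le_of_lt hs't⟩))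
    obtain ⟨e, hqe, hez, hinj⟩ := hf.exists_injOn_left hzq (p * N)
    refine hT.not_exceptional_left hf.continuous hM hqe ((Ioo_subset_Ioo_left hez).trans hsub)
      (hG q hqE) hlt (fun t ht htq => ?_) hinj hxint hxq (hIT hxI) hqx
    rcases htq.lt_or_eq with h | rfl
    · exact (hgt t ht h).le
    · exact (hG q hqE).ge

/-! ### Dense backward orbits -/

theorem exists_backward_of_subset_image {f : ℝ → ℝ} {T : Set ℝ} (h : T ⊆ f '' T) {x : ℝ}
    (hx : x ∈ T) : ∃ y : ℕ → ℝ, y 0 = x ∧ (∀ n, y n ∈ T) ∧ ∀ n, f (y (n + 1)) = y n := by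
  have h' : ∀ t ∈ T, ∃ s, s ∈ T ∧ f s = t := fun t ht => h ht
  choose! g hgT hg using h'
  exact ⟨fun n => g^[n] x, rfl, fun n => MapsTo.iterate hgT n hx, fun n => by
    dsimp only
    rw [Function.iterate_succ_apply']
    exact hg _ (MapsTo.iterate hgT n hx)⟩

/-- The tail of `y` after index `n` is replaced by a path from a point `v ∈ V` with `f^[m] v = y n`,
continued backward from `v` inside `T`. The index `n'` strictly increases even when `V` is empty, so
that iterating the construction fixes every coordinate. -/
theorem exists_backward_extension {f : ℝ → ℝ} {T V : Set ℝ} (hT : MapsTo f T T) (h : T ⊆ f '' T)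
    (hVT : V ⊆ T) (hV : V.Nonempty → T ⊆ forwardUnion f V) {y : ℕ → ℝ} (hyT : ∀ n, y n ∈ T)
    (hy : ∀ n, f (y (n + 1)) = y n) (n : ℕ) :
    ∃ (y' : ℕ → ℝ) (n' : ℕ), (∀ i, y' i ∈ T) ∧ (∀ i, f (y' (i + 1)) = y' i) ∧ n < n' ∧
      (∀ i ≤ n, y' i = y i) ∧ (V.Nonempty → ∃ i ≤ n', y' i ∈ V) := by
  by_cases hne : V.Nonempty
  swap
  · exact ⟨y, n + 1, hyT, hy, n.lt_succ_self, fun _ _ => rfl, fun h => absurd h hne⟩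
  obtain ⟨m, v, hv, hvm⟩ := mem_forwardUnion.1 (hV hne (hyT n))
  obtain ⟨w, hw0, hwT, hw⟩ := exists_backward_of_subset_image h (hVT hv)
  -- Truncated subtraction joins two regimes: for `n < i ≤ n + m` the value is `f^[m - (i - n)] v`,
  -- and afterwards it is `w (i - n - m)`.
  refine ⟨fun i => if i ≤ n then y i else f^[m - (i - n)] (w (i - n - m)), n + m + 1, fun i => ?_,
    fun i => ?_, by omega, fun i hi => if_pos hi, fun _ => ?_⟩
  · dsimp only
    split_ifs
    · exact hyT i
    · exact hT.iterate _ (hwT _)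
  · dsimp only
    have key : ∀ j, f (f^[m - (j + 1)] (w (j + 1 - m))) = f^[m - j] (w (j - m)) := by
      intro j
      rcases Nat.lt_or_ge j m with hj | hj
      · rw [← Function.iterate_succ_apply' f, show j + 1 - m = 0 by omega,
          show j - m = 0 by omega, show (m - (j + 1)).succ = m - j by omega]
      · rw [show m - (j + 1) = 0 by omega, show m - j = 0 by omega,
          show j + 1 - m = (j - m) + 1 by omega]
        exact hw _
    rcases lt_trichotomy i n with hi | rfl | hi
    · rw [if_pos (by omega), if_pos (by omega), hy]
    · rw [if_neg (by omega), if_pos le_rfl]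
      have := key 0
      simp only [zero_add, Nat.sub_zero, Nat.zero_sub, hw0, hvm] at this
      simpa using this
    · rw [if_neg (by omega), if_neg (by omega), show i + 1 - n = (i - n) + 1 by omega]
      exact key _
  · rcases Nat.eq_zero_or_pos m with rfl | hm
    · exact ⟨n, by omega, by simpa [← hvm] using hv⟩
    · refine ⟨n + m, by omega, ?_⟩
      dsimp only
      rw [if_neg (by omega)]
      simpa [hw0] using hv

theorem exists_backward_meeting {f : ℝ → ℝ} {T : Set ℝ} (hT : MapsTo f T T) (h : T ⊆ f '' T)
    (V : ℕ → Set ℝ) (hVT : ∀ k, V k ⊆ T) (hV : ∀ k, (V k).Nonempty → T ⊆ forwardUnion f (V k))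
    {x : ℝ} (hx : x ∈ T) : ∃ y : ℕ → ℝ, y 0 = x ∧ (∀ n, y n ∈ T) ∧ (∀ n, f (y (n + 1)) = y n) ∧
      ∀ k, (V k).Nonempty → ∃ i, y i ∈ V k := by
  let Y := {y : ℕ → ℝ // (∀ n, y n ∈ T) ∧ ∀ n, f (y (n + 1)) = y n}
  have step : ∀ (k : ℕ) (σ : Y × ℕ), ∃ σ' : Y × ℕ, σ.2 < σ'.2 ∧
      (∀ i ≤ σ.2, σ'.1.1 i = σ.1.1 i) ∧ ((V k).Nonempty → ∃ i ≤ σ'.2, σ'.1.1 i ∈ V k) := by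
    rintro k ⟨⟨y, hyT, hy⟩, n⟩
    obtain ⟨y', n', h1, h2, h3, h4, h5⟩ :=
      exists_backward_extension hT h (hVT k) (hV k) hyT hy n
    exact ⟨(⟨y', h1, h2⟩, n'), h3, h4, h5⟩
  choose F hF1 hF2 hF3 using step
  obtain ⟨y₀, hy₀, hy₀T, hy₀s⟩ := exists_backward_of_subset_image h hx
  -- Stage `k` carries a full backward orbit and an index up to which it is final; the limit orbit
  -- is read off the diagonal.
  let σ : ℕ → Y × ℕ := fun k => Nat.rec (⟨y₀, hy₀T, hy₀s⟩, 0) (fun k s => F k s) k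
  have hσ : ∀ k, σ (k + 1) = F k (σ k) := fun k => rfl
  have hn : ∀ k, k ≤ (σ k).2 := by
    intro k
    induction k with
    | zero => exact Nat.zero_le _
    | succ k ih => exact Nat.succ_le_of_lt (ih.trans_lt (hσ k ▸ hF1 k (σ k)))
  have hmono : Monotone fun k => (σ k).2 :=
    monotone_nat_of_le_succ fun k => (hσ k ▸ hF1 k (σ k) : (σ k).2 < (σ (k + 1)).2).le
  have hag : ∀ j k, j ≤ k → ∀ i ≤ (σ j).2, (σ k).1.1 i = (σ j).1.1 i := by
    intro j k hjk i hi
    induction k, hjk using Nat.le_induction with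
    | base => rfl
    | succ k hjk ih =>
      rw [← ih, hσ k]
      exact hF2 k (σ k) i (hi.trans (hmono hjk))
  have hy : ∀ i k, i ≤ (σ k).2 → (σ i).1.1 i = (σ k).1.1 i := by
    intro i k hik
    rcases le_total i k with hl | hl
    · exact (hag i k hl i (hn i)).symm
    · exact hag k i hl i hik
  refine ⟨fun i => (σ i).1.1 i, hy₀, fun i => (σ i).1.2.1 i, fun i => ?_, fun k hk => ?_⟩
  · dsimp only
    rw [hy i (i + 1) (i.le_succ.trans (hn _))]
    exact (σ (i + 1)).1.2.2 i
  · obtain ⟨i, hi, hiV⟩ := hF3 k (σ k) hk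
    exact ⟨i, by
      dsimp only
      rw [hy i (k + 1) (hσ k ▸ hi), hσ k]
      exact hiV⟩

theorem IsTransitiveOn.exists_dense_backward (hf : IsFold f c) (hT : IsTransitiveOn f T) {x : ℝ}
    (hx : x ∈ T) : ∃ y : ℕ → ℝ, y 0 = x ∧ (∀ n, y n ∈ T) ∧ (∀ n, f (y (n + 1)) = y n) ∧
      T ⊆ closure (range y) := by
  obtain ⟨b, hbc, -, hb⟩ := TopologicalSpace.exists_countable_basis ℝ
  have hbne : b.Nonempty := by
    obtain ⟨v, hv, -⟩ := hb.exists_subset_of_mem_open (mem_univ x) isOpen_univ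
    exact ⟨v, hv⟩
  obtain ⟨B, rfl⟩ := hbc.exists_eq_range hbne
  have hne : (interior T).Nonempty := closure_nonempty_iff.1 ⟨x, hT.subset_closure_interior hx⟩
  have hVT : ∀ k, B k ∩ interior T ⊆ T := fun k => inter_subset_right.trans interior_subset
  obtain ⟨y, h0, hyT, hy, hyV⟩ := exists_backward_meeting hT.mapsTo
    (hT.subset_image hf isOpen_interior hne interior_subset) (fun k => B k ∩ interior T) hVT
    (fun k hk => hT.subset_forwardUnion_of_isOpen hf ((hb.isOpen (mem_range_self k)).inter isOpen_interior)
      hk (hVT k)) hx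
  refine ⟨y, h0, hyT, hy, hT.subset_closure_interior.trans (closure_minimal ?_ isClosed_closure)⟩
  intro t ht
  refine hb.mem_closure_iff.2 ?_
  rintro _ ⟨k, rfl⟩ htk
  obtain ⟨i, hi⟩ := hyV k ⟨t, htk, ht⟩
  exact ⟨y i, hi.1, mem_range_self i⟩

end Fold

/-! ### Limit sets and attractors -/

section Attractor

variable {f : ℝ → ℝ} {a b c x y : ℝ} {A : Set ℝ}

theorem mem_omega_iff : y ∈ omega f x ↔ ∀ s ∈ 𝓝 y, ∃ᶠ n : ℕ in atTop, f^[n] x ∈ s :=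
  mapClusterPt_iff_frequently

theorem omega_subset_of_isClosed {B : Set ℝ} (hB : IsClosed B) (h : ∀ n, f^[n] x ∈ B) :
    omega f x ⊆ B := by
  intro y hy
  rw [← hB.closure_eq, mem_closure_iff_nhds]
  intro s hs
  obtain ⟨n, hn⟩ := (mem_omega_iff.1 hy s hs).exists
  exact ⟨_, hn, h n⟩

theorem omega_nonempty (h : ∀ n, f^[n] x ∈ Icc a b) : (omega f x).Nonempty := by
  obtain ⟨y, -, hy⟩ := isCompact_Icc.exists_mapClusterPt_of_frequently
    (l := atTop) (f := fun n : ℕ => f^[n] x) (Eventually.of_forall h).frequently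
  exact ⟨y, hy⟩

theorem mapsTo_omega (hf : Continuous f) : MapsTo f (omega f x) (omega f x) := by
  intro y hy
  rw [mem_omega_iff] at hy ⊢
  intro s hs
  refine frequently_atTop.2 fun N => ?_
  obtain ⟨n, hn, hns⟩ := frequently_atTop.1 (hy _ (hf.continuousAt hs)) N
  exact ⟨n + 1, by omega, by rw [Function.iterate_succ_apply']; exact hns⟩

/-- If the orbit converges to `y` along an ultrafilter, compactness makes the orbit delayed by one
step converge along the same ultrafilter, to a preimage of `y`. -/
theorem omega_subset_image_omega (hf : Continuous f) (h : ∀ n, f^[n] x ∈ Icc a b) :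
    omega f x ⊆ f '' omega f x := by
  intro y hy
  obtain ⟨U, hU, hUy⟩ := mapClusterPt_iff_ultrafilter.1 hy
  have hpred : Tendsto (fun n : ℕ => n - 1) U atTop := (tendsto_sub_atTop_nat 1).mono_left hU
  obtain ⟨z, -, hz⟩ := isCompact_Icc.ultrafilter_le_nhds
    (U.map fun n : ℕ => f^[n - 1] x) (by
      rw [le_principal_iff]
      exact Eventually.of_forall (f := (U : Filter ℕ)) fun n => h (n - 1))
  have hz' : Tendsto (fun n : ℕ => f^[n - 1] x) U (𝓝 z) := hz
  refine ⟨z, mapClusterPt_iff_ultrafilter.2 ⟨U.map fun n : ℕ => n - 1, hpred, hz'⟩, ?_⟩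
  refine tendsto_nhds_unique ((hf.tendsto z).comp hz') (hUy.congr' ?_)
  filter_upwards [hU (eventually_ge_atTop 1)] with n hn
  rw [Function.comp_apply, ← Function.iterate_succ_apply' f, Nat.succ_eq_add_one,
    Nat.sub_add_cancel hn]

theorem basin_mono {A B : Set ℝ} (h : A ⊆ B) : basin f a b A ⊆ basin f a b B :=
  fun _ hx => ⟨hx.1, hx.2.trans h⟩

theorem subset_basin {B V : Set ℝ} (hB : IsClosed B) (hmaps : MapsTo f B B) (hVB : V ⊆ B)
    (hV : V ⊆ Icc a b) : V ⊆ basin f a b B :=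
  fun _ hx => ⟨hV hx, omega_subset_of_isClosed hB fun n => hmaps.iterate n (hVB hx)⟩

/-- A closed invariant set whose basin has positive measure contains an attractor. -/
theorem exists_isAttractor_subset (hf : Continuous f) {B : Set ℝ} (hB : IsClosed B)
    (hBab : B ⊆ Icc a b) (hmaps : MapsTo f B B) (hpos : 0 < volume (basin f a b B)) :
    ∃ A ⊆ B, IsAttractor f a b A := by
  set N : Set ℝ → Set ℝ := fun O => {x | x ∈ basin f a b B ∧ (omega f x ∩ O).Nonempty} with hN
  -- Milnor's likely limit set: the points near which a non-null part of the basin accumulates. By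
  -- the Lindelöf property, almost every point of the basin has its limit set in `A`.
  set A : Set ℝ := {y | y ∈ B ∧ ∀ O, IsOpen O → y ∈ O → volume (N O) ≠ 0} with hA
  have hAB : A ⊆ B := fun y hy => hy.1
  have hcl : IsClosed A := by
    refine isClosed_of_closure_subset fun y hy => ⟨hB.closure_subset (closure_mono hAB hy), ?_⟩
    intro O hO hyO
    obtain ⟨z, hzO, hz⟩ := mem_closure_iff.1 hy O hO hyO
    exact hz.2 O hO hzO
  have hinv : MapsTo f A A := by
    refine fun y hy => ⟨hmaps hy.1, fun O hO hyO h0 => ?_⟩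
    refine hy.2 (f ⁻¹' O) (hO.preimage hf) hyO (measure_mono_null ?_ h0)
    rintro x ⟨hx, w, hw, hwO⟩
    exact ⟨hx, f w, mapsTo_omega hf hw, hwO⟩
  have hnull : volume (basin f a b B \ basin f a b A) = 0 := by
    have hloc : ∀ y ∈ B \ A, ∃ O, IsOpen O ∧ y ∈ O ∧ volume (N O) = 0 := by
      rintro y ⟨hyB, hyA⟩
      by_contra! h
      exact hyA ⟨hyB, h⟩
    choose! O hO hyO hO0 using hloc
    obtain ⟨S, hSBA, hSc, hSU⟩ := TopologicalSpace.countable_cover_nhdsWithin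
      (s := B \ A) (f := O) fun y hy => mem_nhdsWithin_of_mem_nhds ((hO y hy).mem_nhds (hyO y hy))
    refine measure_mono_null (t := ⋃ y ∈ S, N (O y)) ?_
      ((measure_biUnion_null_iff hSc).2 fun y hy => hO0 y (hSBA hy))
    rintro x ⟨hxB, hxA⟩
    have : ¬ omega f x ⊆ A := fun h => hxA ⟨hxB.1, h⟩
    obtain ⟨w, hw, hwA⟩ := not_subset.1 this
    obtain ⟨y, hyS, hwy⟩ := mem_iUnion₂.1 (hSU ⟨hxB.2 hw, hwA⟩)
    exact mem_biUnion hyS ⟨hxB, w, hw, hwy⟩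
  refine ⟨A, hAB, hcl, hAB.trans hBab, hinv, ?_, fun A' hA' hA'cl _ h0 => ?_⟩
  · refine pos_iff_ne_zero.2 fun h0 => hpos.ne' ?_
    refine measure_mono_null (fun x hx => ?_) (measure_union_null h0 hnull)
    by_cases h : x ∈ basin f a b A
    · exact Or.inl h
    · exact Or.inr ⟨hx, h⟩
  · obtain ⟨y, hyA, hyA'⟩ := exists_of_ssubset hA'
    refine hyA.2 A'ᶜ hA'cl.isOpen_compl hyA' (measure_mono_null ?_ (measure_union_null hnull h0))
    rintro x ⟨hx, w, hw, hwA'⟩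
    by_cases h : x ∈ basin f a b A
    · exact Or.inr ⟨h, fun h' => hwA' (h'.2 hw)⟩
    · exact Or.inl ⟨hx, h⟩

theorem closure_forwardUnion_subset_Icc (hmaps : MapsTo f (Icc a b) (Icc a b)) {V : Set ℝ}
    (hV : V ⊆ Icc a b) : closure (forwardUnion f V) ⊆ Icc a b :=
  closure_minimal (forwardUnion_subset hV hmaps) isClosed_Icc

theorem subset_closure_forwardUnion_of_unique (hf : Continuous f)
    (hmaps : MapsTo f (Icc a b) (Icc a b)) (huniq : ∀ B, IsAttractor f a b B → B = A)
    {V : Set ℝ} (hVo : IsOpen V) (hne : V.Nonempty) (hV : V ⊆ Icc a b) :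
    A ⊆ closure (forwardUnion f V) := by
  have hinv : MapsTo f (closure (forwardUnion f V)) (closure (forwardUnion f V)) :=
    mapsTo_forwardUnion.closure hf
  obtain ⟨B, hB, hBatt⟩ := exists_isAttractor_subset hf isClosed_closure
    (closure_forwardUnion_subset_Icc hmaps hV) hinv
    ((hVo.measure_pos volume hne).trans_le (measure_mono
      (subset_basin isClosed_closure hinv (subset_forwardUnion.trans subset_closure) hV)))
  exact huniq B hBatt ▸ hB

/-- Since every limit set satisfies `ω ⊆ f(ω)`, the closed invariant set `f '' A` has the same basin
as `A`, and minimality excludes that it is smaller. -/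
theorem IsAttractor.subset_image (hf : Continuous f) (hmaps : MapsTo f (Icc a b) (Icc a b))
    (hA : IsAttractor f a b A) : A ⊆ f '' A := by
  by_contra h
  have hcpt : IsCompact A := isCompact_Icc.of_isClosed_subset hA.isClosed hA.subset
  refine hA.minimal (f '' A) ⟨hA.invariant.image_subset, h⟩ (hcpt.image hf).isClosed
    (fun x hx => mem_image_of_mem f (hA.invariant.image_subset hx)) ?_
  rw [sdiff_eq_empty.2, measure_empty]
  exact fun x hx => ⟨hx.1, (omega_subset_image_omega hf fun n => hmaps.iterate n hx.1).trans
    (image_mono hx.2)⟩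

theorem range_iterate_eq {M : ℕ} (hM : 0 < M) {q : ℝ} (hq : f^[M] q = q) (i : ℕ) :
    range (fun j : ℕ => f^[j] (f^[i] q)) = range fun j : ℕ => f^[j] q := by
  refine Subset.antisymm ?_ ?_
  · rintro _ ⟨j, rfl⟩
    exact ⟨j + i, Function.iterate_add_apply f j i q⟩
  · rintro _ ⟨j, rfl⟩
    refine ⟨j + (M * i - i), ?_⟩
    dsimp only
    rw [← Function.iterate_add_apply, add_assoc,
      Nat.sub_add_cancel (Nat.le_mul_of_pos_left i hM), Function.iterate_add_apply,
      Function.iterate_mul, Function.iterate_fixed hq]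

theorem finite_range_iterate {M : ℕ} (hM : 0 < M) {q : ℝ} (hq : f^[M] q = q) :
    (range fun j : ℕ => f^[j] q).Finite := by
  refine ((Finset.range M).finite_toSet.image fun j => f^[j] q).subset ?_
  rintro _ ⟨n, rfl⟩
  refine ⟨n % M, by simpa using Nat.mod_lt n hM, ?_⟩
  dsimp only
  rw [iterate_eq_iterate_mod f M n, Function.iterate_fixed hq]

/-- An invariant proper subset of a cycle is empty, and its basin is empty because limit sets in
`[a,b]` are not. -/
theorem IsCycle.isAttractor (hmaps : MapsTo f (Icc a b) (Icc a b)) {P : Set ℝ}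
    (hP : IsCycle f a b P) (hpos : 0 < volume (basin f a b P)) : IsAttractor f a b P := by
  obtain ⟨q, hqab, M, hM, hq, rfl⟩ := hP
  refine ⟨(finite_range_iterate hM hq).isClosed, ?_, ?_, hpos, fun A' hA' _ hinv h0 => ?_⟩
  · rintro _ ⟨n, rfl⟩
    exact hmaps.iterate n hqab
  · rintro _ ⟨n, rfl⟩
    exact ⟨n + 1, Function.iterate_succ_apply' f n q⟩
  · have hA'e : A' = ∅ := by
      by_contra hne
      obtain ⟨z, hz⟩ := nonempty_iff_ne_empty.2 hne
      obtain ⟨i, rfl⟩ := hA'.1 hz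
      refine hA'.2 ?_
      rw [← range_iterate_eq hM hq i]
      rintro _ ⟨j, rfl⟩
      exact hinv.iterate j hz
    have hbasin : basin f a b A' = ∅ := by
      refine eq_empty_of_forall_notMem fun x hx => ?_
      obtain ⟨y, hy⟩ := omega_nonempty fun n => hmaps.iterate n hx.1
      exact absurd (hx.2 hy) (by simp [hA'e])
    rw [hbasin, sdiff_empty] at h0
    exact hpos.ne' h0

theorem omega_subset_range_iterate (hf : Continuous f) {M : ℕ} (hM : 0 < M) {q w : ℝ}
    (h : Tendsto (fun n => (f^[M])^[n] w) atTop (𝓝 q)) :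
    omega f w ⊆ range fun j : ℕ => f^[j] q := by
  intro y hy
  by_contra hyq
  obtain ⟨U, hU, Q, hQ, hUQ⟩ := exists_nhds_iterate_ne hf (M := M) (q := q) (t := y)
    fun i _ hi => hyq ⟨i, hi⟩
  obtain ⟨N, hN⟩ := eventually_atTop.1 (h.eventually hU)
  obtain ⟨n, hn, hnQ⟩ := frequently_atTop.1 (mem_omega_iff.1 hy Q hQ) (N * M)
  rw [iterate_eq_iterate_mod f M] at hnQ
  exact hUQ _ (hN _ ((Nat.le_div_iff_mul_le hM).2 hn)) _ hnQ _ (Nat.mod_lt _ hM) rfl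

end Attractor

/-! ### Absence of intervals on which all iterates are injective -/

theorem strictMonoOn_or_strictAntiOn_of_injOn {F : ℝ → ℝ} {C : Set ℝ} (hC : C.OrdConnected)
    (hF : ContinuousOn F C) (hinj : InjOn F C) : StrictMonoOn F C ∨ StrictAntiOn F C := by
  have key : ∀ x ∈ C, ∀ y ∈ C, x < y → ∀ x' ∈ C, ∀ y' ∈ C, x' < y' → F x < F y → F x' < F y' := by
    intro x hx y hy hxy x' hx' y' hy' hxy' h
    have hm : min x x' ∈ C := by rcases min_choice x x' with h | h <;> rw [h] <;> assumption
    have hM : max y y' ∈ C := by rcases max_choice y y' with h | h <;> rw [h] <;> assumption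
    have hsub := hC.out hm hM
    have hle : min x x' ≤ max y y' := (min_le_left _ _).trans (hxy.le.trans (le_max_left _ _))
    have mem_x : x ∈ Icc (min x x') (max y y') :=
      ⟨min_le_left _ _, hxy.le.trans (le_max_left _ _)⟩
    have mem_y : y ∈ Icc (min x x') (max y y') :=
      ⟨(min_le_left _ _).trans hxy.le, le_max_left _ _⟩
    have mem_x' : x' ∈ Icc (min x x') (max y y') :=
      ⟨min_le_right _ _, hxy'.le.trans (le_max_right _ _)⟩
    have mem_y' : y' ∈ Icc (min x x') (max y y') :=
      ⟨(min_le_right _ _).trans hxy'.le, le_max_right _ _⟩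
    rcases ContinuousOn.strictMonoOn_of_injOn_Icc' hle (hF.mono hsub) (hinj.mono hsub) with hs | hs
    · exact hs mem_x' mem_y' hxy'
    · exact absurd h (hs mem_x mem_y hxy).not_gt
  by_cases h : ∃ x ∈ C, ∃ y ∈ C, x < y ∧ F x < F y
  · obtain ⟨x, hx, y, hy, hxy, hF'⟩ := h
    exact Or.inl fun x' hx' y' hy' hxy' => key x hx y hy hxy x' hx' y' hy' hxy' hF'
  · push Not at h
    exact Or.inr fun x hx y hy hxy => (h x hx y hy hxy).lt_of_ne
      fun he => hxy.ne (hinj hx hy he.symm)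

/-- A continuous map with one turning point on `[a,b]` which has no wandering interval and for
which every periodic orbit has a null basin. -/
structure IsTame (f : ℝ → ℝ) (a b c : ℝ) : Prop where
  isFold : IsFold f c
  mem : c ∈ Ioo a b
  mapsTo : MapsTo f (Icc a b) (Icc a b)
  exists_inter : ∀ l r : ℝ, l < r → Icc l r ⊆ Icc a b →
    ∃ i j : ℕ, i < j ∧ (f^[i] '' Icc l r ∩ f^[j] '' Icc l r).Nonempty
  volume_basin : ∀ P : Set ℝ, IsCycle f a b P → volume (basin f a b P) = 0

section Tame

variable {f : ℝ → ℝ} {a b c : ℝ} {A : Set ℝ}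

/-- Monotonicity squeezes the orbits of all points between `y` and `z` to `q`, so a cycle would
attract an interval. -/
theorem IsTame.not_tendsto (hf : IsTame f a b c) {M : ℕ} (hM : 0 < M) {C : Set ℝ}
    (hC : C.OrdConnected) (hCab : C ⊆ Icc a b) (hmaps : MapsTo f^[M] C C)
    (hmono : StrictMonoOn f^[M] C) {y z q : ℝ} (hy : y ∈ C) (hz : z ∈ C) (hyz : y < z)
    (hyq : Tendsto (fun n => (f^[M])^[n] y) atTop (𝓝 q))
    (hzq : Tendsto (fun n => (f^[M])^[n] z) atTop (𝓝 q)) : False := by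
  have hq : f^[M] q = q :=
    isFixedPt_of_tendsto_iterate hyq (hf.isFold.continuous.iterate M).continuousAt
  have hqab : q ∈ Icc a b :=
    isClosed_Icc.mem_of_tendsto hyq (Eventually.of_forall fun n => hCab (hmaps.iterate n hy))
  have hle : ∀ u ∈ C, ∀ v ∈ C, u ≤ v → ∀ n, (f^[M])^[n] u ≤ (f^[M])^[n] v := by
    intro u hu v hv huv n
    induction n with
    | zero => exact huv
    | succ n ih =>
      rw [Function.iterate_succ_apply', Function.iterate_succ_apply']
      exact hmono.monotoneOn (hmaps.iterate n hu) (hmaps.iterate n hv) ih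
  have hsub : Ioo y z ⊆ basin f a b (range fun j : ℕ => f^[j] q) := by
    intro w hw
    have hwC : w ∈ C := hC.out hy hz ⟨hw.1.le, hw.2.le⟩
    refine ⟨hCab hwC, omega_subset_range_iterate hf.isFold.continuous hM ?_⟩
    exact tendsto_of_tendsto_of_tendsto_of_le_of_le hyq hzq (fun n => hle y hy w hwC hw.1.le n)
      (fun n => hle w hwC z hz hw.2.le n)
  have h0 := measure_mono_null hsub (hf.volume_basin _ ⟨q, hqab, M, hM, hq, rfl⟩)
  exact (isOpen_Ioo.measure_pos volume (nonempty_Ioo.2 hyz)).ne' h0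

/-- The orbit of `y` under a monotone map is monotone and converges. If `y` moved, then `y` and its
image would be distinct points with the same limit. -/
theorem IsTame.iterate_eq_self (hf : IsTame f a b c) {M : ℕ} (hM : 0 < M) {C : Set ℝ}
    (hC : C.OrdConnected) (hCab : C ⊆ Icc a b) (hmaps : MapsTo f^[M] C C)
    (hmono : StrictMonoOn f^[M] C) {y : ℝ} (hy : y ∈ C) : f^[M] y = y := by
  have hmem : ∀ n, (f^[M])^[n] y ∈ C := fun n => hmaps.iterate n hy
  have hshift : ∀ q, Tendsto (fun n => (f^[M])^[n] y) atTop (𝓝 q) →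
      Tendsto (fun n => (f^[M])^[n] (f^[M] y)) atTop (𝓝 q) := fun q hq =>
    (hq.comp (tendsto_add_atTop_nat 1)).congr fun n => Function.iterate_succ_apply _ _ _
  rcases lt_trichotomy (f^[M] y) y with h | h | h
  · exfalso
    have hstep : Antitone fun n => (f^[M])^[n] y := by
      refine antitone_nat_of_succ_le fun n => ?_
      induction n with
      | zero => exact h.le
      | succ n ih =>
        have := hmono.monotoneOn (hmem (n + 1)) (hmem n) ih
        rwa [← Function.iterate_succ_apply' f^[M], ← Function.iterate_succ_apply' f^[M]] at this
    have hlim := tendsto_atTop_ciInf hstep ⟨a, by rintro _ ⟨n, rfl⟩; exact (hCab (hmem n)).1⟩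
    exact hf.not_tendsto hM hC hCab hmaps hmono (hmaps hy) hy h (hshift _ hlim) hlim
  · exact h
  · exfalso
    have hstep : Monotone fun n => (f^[M])^[n] y := by
      refine monotone_nat_of_le_succ fun n => ?_
      induction n with
      | zero => exact h.le
      | succ n ih =>
        rw [Function.iterate_succ_apply', Function.iterate_succ_apply' _ (n + 1)]
        exact hmono.monotoneOn (hmem _) (hmem _) ih
    have hlim := tendsto_atTop_ciSup hstep ⟨b, by rintro _ ⟨n, rfl⟩; exact (hCab (hmem n)).2⟩
    exact hf.not_tendsto hM hC hCab hmaps hmono hy (hmaps hy) h hlim (hshift _ hlim)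

/-- Small neighbourhoods of an interior point `y` have forward images only near the cycle of `y`.
The density hypothesis then places `A` inside this cycle, whose basin is null. -/
theorem IsTame.interior_eq_empty_of_iterate_eq_self (hf : IsTame f a b c)
    (hA : 0 < volume (basin f a b A))
    (hdense : ∀ V, IsOpen V → V.Nonempty → V ⊆ Icc a b → A ⊆ closure (forwardUnion f V))
    {M : ℕ} (hM : 0 < M) {C : Set ℝ} (hCab : C ⊆ Icc a b) (hfix : ∀ y ∈ C, f^[M] y = y) :
    interior C = ∅ := by
  refine eq_empty_of_forall_notMem fun y hy => ?_
  have hyC := interior_subset hy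
  have hsub : A ⊆ range fun j : ℕ => f^[j] y := by
    intro t ht
    by_contra hty
    obtain ⟨U, hU, Q, hQ, hUQ⟩ := exists_nhds_iterate_ne hf.isFold.continuous (M := M) (q := y)
      (t := t) fun i _ hi => hty ⟨i, hi⟩
    have hDC : interior C ∩ interior U ⊆ C := inter_subset_left.trans interior_subset
    refine notMem_closure_forwardUnion hM hQ (D := interior C ∩ interior U) (fun z hz => ?_)
      (fun z hz => hUQ z (interior_subset hz.2)) ?_
    · rwa [hfix z (hDC hz)]
    · exact hdense _ (isOpen_interior.inter isOpen_interior)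
        ⟨y, hy, mem_interior_iff_mem_nhds.2 hU⟩ (hDC.trans hCab) ht
  exact hA.ne' (measure_mono_null (basin_mono hsub)
    (hf.volume_basin _ ⟨y, hCab hyC, M, hM, hfix y hyC, rfl⟩))

/-- If all images avoided `c`, all iterates would be injective on the interval. Two images meet, so
one of them generates a connected set `C` mapped injectively into itself by some `f^[p]`; then all
of `C` is periodic, although it has interior. -/
theorem IsTame.exists_turning_mem_image (hf : IsTame f a b c) (hA : 0 < volume (basin f a b A))
    (hdense : ∀ V, IsOpen V → V.Nonempty → V ⊆ Icc a b → A ⊆ closure (forwardUnion f V))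
    {u v : ℝ} (huv : u < v) (hab : Ioo u v ⊆ Icc a b) : ∃ n, c ∈ f^[n] '' Ioo u v := by
  by_contra! h
  have hcont := hf.isFold.continuous
  obtain ⟨l, hul, hlv⟩ := exists_between huv
  obtain ⟨r, hlr, hrv⟩ := exists_between hlv
  have hsub : Icc l r ⊆ Ioo u v := fun x hx => ⟨hul.trans_le hx.1, hx.2.trans_lt hrv⟩
  obtain ⟨i, j, hij, z, hzi, hzj⟩ := hf.exists_inter l r hlr (hsub.trans hab)
  set V := f^[i] '' Ioo u v with hV
  have hVpre : IsPreconnected V := isPreconnected_Ioo.image _ (hcont.iterate i).continuousOn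
  have hret : (V ∩ f^[j - i] '' V).Nonempty := by
    refine ⟨z, image_mono hsub hzi, ?_⟩
    rw [hV, ← image_comp, ← Function.iterate_add, Nat.sub_add_cancel hij.le]
    exact image_mono hsub hzj
  obtain ⟨C, hC, hVC, hCmaps, hCV⟩ := exists_preconnected_mapsTo hcont hVpre hret
  have hp : 0 < j - i := Nat.sub_pos_of_lt hij
  set p := j - i
  have hVab : V ⊆ Icc a b := (image_mono hab).trans (hf.mapsTo.iterate i).image_subset
  have hCab : C ⊆ Icc a b := hCV.trans (forwardUnion_subset hVab hf.mapsTo)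
  have hCc : ∀ n, c ∉ f^[n] '' C := by
    rintro n ⟨w, hw, hwc⟩
    obtain ⟨m, _, ⟨t, ht, rfl⟩, rfl⟩ := mem_forwardUnion.1 (hCV hw)
    refine h (n + (m + i)) ⟨t, ht, ?_⟩
    rw [Function.iterate_add_apply, Function.iterate_add_apply, hwc]
  -- Doubling the period turns a decreasing return map into an increasing one.
  have hmono : StrictMonoOn f^[p + p] C := by
    rw [Function.iterate_add]
    rcases strictMonoOn_or_strictAntiOn_of_injOn hC.ordConnected (hcont.iterate p).continuousOn
      (hf.isFold.injOn_iterate_of_notMem hC fun n _ => hCc n) with h' | h'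
    · exact h'.comp h' hCmaps
    · exact h'.comp h' hCmaps
  have hmaps : MapsTo f^[p + p] C C := by
    rw [Function.iterate_add]
    exact hCmaps.comp hCmaps
  have hempty := hf.interior_eq_empty_of_iterate_eq_self hA hdense (Nat.add_pos_left hp p) hCab
    fun y hy => hf.iterate_eq_self (Nat.add_pos_left hp p) hC.ordConnected hCab hmaps hmono hy
  have hne := hf.isFold.interior_iterate_image_nonempty isOpen_Ioo (nonempty_Ioo.2 huv) i
  exact (hne.mono (interior_mono hVC)).ne_empty hempty

/-- At the first time `n` that the image contains `c`, the iterate is still injective on the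
interval, so the image is a neighbourhood of `c`. -/
theorem IsTame.exists_ball_subset_forwardUnion (hf : IsTame f a b c)
    (hA : 0 < volume (basin f a b A))
    (hdense : ∀ V, IsOpen V → V.Nonempty → V ⊆ Icc a b → A ⊆ closure (forwardUnion f V))
    {V : Set ℝ} (hV : IsOpen V) (hne : V.Nonempty) (hVab : V ⊆ Icc a b) :
    ∃ ε > 0, Metric.ball c ε ⊆ forwardUnion f V := by
  classical
  obtain ⟨x, hx⟩ := hne
  obtain ⟨u, v, hux, hxv, huv⟩ := exists_Ioo_subset_of_isOpen hV hx
  have hex := hf.exists_turning_mem_image hA hdense (hux.trans hxv) (huv.trans hVab)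
  have hcont := hf.isFold.continuous.iterate (Nat.find hex)
  obtain ⟨t, ht, htc⟩ := Nat.find_spec hex
  have hinj := hf.isFold.injOn_iterate_of_notMem isPreconnected_Ioo fun i hi => Nat.find_min hex hi
  set n := Nat.find hex
  obtain ⟨l, hul, hlt⟩ := exists_between ht.1
  obtain ⟨r, htr, hrv⟩ := exists_between ht.2
  have hl : l ∈ Ioo u v := ⟨hul, hlt.trans ht.2⟩
  have hr : r ∈ Ioo u v := ⟨ht.1.trans htr, hrv⟩
  have hsub : uIcc (f^[n] l) (f^[n] r) ⊆ f^[n] '' V := by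
    refine (intermediate_value_uIcc hcont.continuousOn).trans (image_mono ?_)
    rw [uIcc_of_le (hlt.trans htr).le]
    exact (ordConnected_Ioo.out hl hr).trans huv
  have hnhds : f^[n] '' V ∈ 𝓝 c := by
    rw [← htc]
    rcases strictMonoOn_or_strictAntiOn_of_injOn ordConnected_Ioo hcont.continuousOn hinj with h | h
    · exact mem_of_superset (Icc_mem_nhds (h hl ht hlt) (h ht hr htr))
        (Icc_subset_uIcc.trans hsub)
    · exact mem_of_superset (Icc_mem_nhds (h ht hr htr) (h hl ht hlt))
        (Icc_subset_uIcc'.trans hsub)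
  obtain ⟨ε, hε, hball⟩ := Metric.mem_nhds_iff.1 hnhds
  exact ⟨ε, hε, hball.trans (subset_iUnion (fun n => f^[n] '' V) n)⟩

/-! ### The dichotomy at the turning point -/

/-- Any open subset has a ball about `c` among its forward images, and by `hVball` that ball
regenerates `V`. -/
theorem IsTame.isTransitiveOn_closure_forwardUnion (hf : IsTame f a b c)
    (hA : 0 < volume (basin f a b A))
    (hdense : ∀ V, IsOpen V → V.Nonempty → V ⊆ Icc a b → A ⊆ closure (forwardUnion f V))
    {V : Set ℝ} (hV : IsOpen V) (hVab : V ⊆ Icc a b)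
    (hVball : ∀ ε > 0, V ⊆ forwardUnion f (Metric.ball c ε)) :
    IsTransitiveOn f (closure (forwardUnion f V)) := by
  have hab := closure_forwardUnion_subset_Icc hf.mapsTo hVab
  refine ⟨isCompact_Icc.of_isClosed_subset isClosed_closure hab,
    mapsTo_forwardUnion.closure hf.isFold.continuous, closure_minimal ?_ isClosed_closure,
    fun V' hV' hne hsub => closure_mono ?_⟩
  · intro x hx
    obtain ⟨n, v, hv, rfl⟩ := mem_forwardUnion.1 hx
    refine mem_closure_iff.2 fun O hO hvO => ?_
    have hsub : f^[n] '' (V ∩ f^[n] ⁻¹' O) ⊆ O ∩ forwardUnion f V := by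
      rintro _ ⟨w, hw, rfl⟩
      exact ⟨hw.2, mem_forwardUnion.2 ⟨n, w, hw.1, rfl⟩⟩
    obtain ⟨z, hz⟩ := hf.isFold.interior_iterate_image_nonempty
      (hV.inter (hO.preimage (hf.isFold.continuous.iterate n))) ⟨v, hv, hvO⟩ n
    exact ⟨z, (hsub (interior_subset hz)).1,
      interior_mono (hsub.trans (inter_subset_right.trans subset_closure)) hz⟩
  · obtain ⟨ε, hε, hball⟩ :=
      hf.exists_ball_subset_forwardUnion hA hdense hV' hne (hsub.trans hab)
    exact forwardUnion_subset_forwardUnion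
      ((hVball ε hε).trans (forwardUnion_subset_forwardUnion hball))

theorem IsTame.exists_ball_subset_Icc (hf : IsTame f a b c) :
    ∃ ε > 0, Metric.ball c ε ⊆ Icc a b :=
  Metric.mem_nhds_iff.1 (Icc_mem_nhds hf.mem.1 hf.mem.2)

theorem IsTame.exists_ball_no_long_interval (hf : IsTame f a b c)
    (h : ∀ V, IsOpen V → V.Nonempty → V ⊆ Icc a b →
      ∃ ε > 0, ¬ V ⊆ forwardUnion f (Metric.ball c ε)) {η : ℝ} (hη : 0 < η) :
    ∃ ε > 0, Metric.ball c ε ⊆ Icc a b ∧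
      ∀ u, ¬ Icc u (u + η) ⊆ forwardUnion f (Metric.ball c ε) := by
  by_contra! hcon
  obtain ⟨ε₀, hε₀, hball⟩ := hf.exists_ball_subset_Icc
  have hpos : ∀ n : ℕ, 0 < ε₀ / (n + 1) := fun n => by positivity
  have hle : ∀ n : ℕ, Metric.ball c (ε₀ / (n + 1)) ⊆ Icc a b := fun n =>
    (Metric.ball_subset_ball (div_le_self hε₀.le (by linarith [n.cast_nonneg (α := ℝ)]))).trans
      hball
  choose u hu using fun n : ℕ => hcon _ (hpos n) (hle n)
  have huab : ∀ n, Icc (u n) (u n + η) ⊆ Icc a b := fun n =>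
    (hu n).trans (forwardUnion_subset (hle n) hf.mapsTo)
  obtain ⟨w, -, φ, hφ, hw⟩ := isCompact_Icc.tendsto_subseq
    fun n => huab n (left_mem_Icc.2 (by linarith : u n ≤ u n + η))
  -- The left endpoints of the long intervals accumulate at `w`, so the middle third of `[w, w + η]`
  -- lies in all late ones, hence in the forward images of arbitrarily small balls.
  have hnear : ∀ᶠ n in atTop, Ioo (w + η / 3) (w + 2 * η / 3) ⊆
      Icc (u (φ n)) (u (φ n) + η) := by
    filter_upwards [hw.eventually (Metric.ball_mem_nhds w (by positivity : 0 < η / 3))]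
      with n hn x hx
    rw [Real.dist_eq, abs_lt] at hn
    simp only [Function.comp_apply] at hn
    exact ⟨by linarith [hx.1], by linarith [hx.2]⟩
  obtain ⟨n, hn⟩ := hnear.exists
  obtain ⟨ε, hε, hnot⟩ := h (Ioo (w + η / 3) (w + 2 * η / 3)) isOpen_Ioo
    (nonempty_Ioo.2 (by linarith)) (hn.trans (huab _))
  have hsmall : ∀ᶠ n : ℕ in atTop, ε₀ / ((φ n : ℕ) + 1 : ℝ) < ε := by
    have h1 : Tendsto (fun n : ℕ => ε₀ / ((n : ℝ) + 1)) atTop (𝓝 0) := by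
      simpa [div_eq_mul_inv] using tendsto_one_div_add_atTop_nhds_zero_nat.const_mul ε₀
    exact (h1.comp hφ.tendsto_atTop).eventually (gt_mem_nhds hε)
  obtain ⟨m, hm1, hm2⟩ := (hnear.and hsmall).exists
  exact hnot (hm1.trans ((hu (φ m)).trans (forwardUnion_subset_forwardUnion
    ((Metric.ball_subset_ball hm2.le).trans subset_forwardUnion))))

theorem dist_le_of_mem_closure {S W : Set ℝ} {η : ℝ} (hS : IsPreconnected S) (hSW : S ⊆ W)
    (h : ∀ u, ¬ Icc u (u + η) ⊆ W) {x y : ℝ} (hx : x ∈ closure S) (hy : y ∈ closure S) :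
    dist x y ≤ η := by
  have key : ∀ s ∈ S, ∀ t ∈ S, s - t ≤ η := by
    intro s hs t ht
    by_contra! hst
    exact h t ((Icc_subset_Icc_right (by linarith)).trans ((hS.ordConnected.out ht hs).trans hSW))
  have hcl : S ×ˢ S ⊆ {p : ℝ × ℝ | dist p.1 p.2 ≤ η} := fun p hp =>
    abs_sub_le_iff.2 ⟨key _ hp.1 _ hp.2, key _ hp.2 _ hp.1⟩
  have hmem : (x, y) ∈ closure (S ×ˢ S) := by
    rw [closure_prod_eq]
    exact ⟨hx, hy⟩
  exact closure_minimal hcl (isClosed_le continuous_dist continuous_const) hmem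

theorem IsTame.exists_dense_backward_of_small (hf : IsTame f a b c)
    (hA : IsAttractor f a b A)
    (hdense : ∀ V, IsOpen V → V.Nonempty → V ⊆ Icc a b → A ⊆ closure (forwardUnion f V))
    (h : ∀ V, IsOpen V → V.Nonempty → V ⊆ Icc a b →
      ∃ ε > 0, ¬ V ⊆ forwardUnion f (Metric.ball c ε)) {x : ℝ} (hx : x ∈ A) :
    ∃ y : ℕ → ℝ, y 0 = x ∧ (∀ n, y n ∈ A) ∧ (∀ n, f (y (n + 1)) = y n) ∧
      A ⊆ closure (range y) := by
  have hcont := hf.isFold.continuous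
  obtain ⟨y, hy0, hyA, hy⟩ := exists_backward_of_subset_image (hA.subset_image hcont hf.mapsTo) hx
  refine ⟨y, hy0, hyA, hy, fun t ht => Metric.mem_closure_range_iff.2 fun η hη => ?_⟩
  obtain ⟨ε, hε, hab, hlong⟩ := hf.exists_ball_no_long_interval h (half_pos hη)
  -- This half of the ball omits `c`, so the time `p` at which its image contains `c` is positive.
  have hsub : Ioo c (c + ε) ⊆ Metric.ball c ε := by
    rw [Real.ball_eq_Ioo]
    exact Ioo_subset_Ioo_left (by linarith)
  obtain ⟨p, hcp⟩ := hf.exists_turning_mem_image hA.basin_pos hdense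
    (by linarith : c < c + ε) (hsub.trans hab)
  have hp : 0 < p := by
    rcases Nat.eq_zero_or_pos p with rfl | hp
    · simp at hcp
    · exact hp
  obtain ⟨C, hC, hUC, hCmaps, hCU⟩ := exists_preconnected_mapsTo hcont
    (convex_ball c ε).isPreconnected ⟨c, Metric.mem_ball_self hε, image_mono hsub hcp⟩
  have hAU := hdense _ Metric.isOpen_ball ⟨c, Metric.mem_ball_self hε⟩ hab
  obtain ⟨s, hs, hys⟩ := exists_mem_closure_iterate_image hp hUC hCmaps (hAU (hyA (2 * p)))
  obtain ⟨r, hr, htr⟩ := exists_mem_closure_iterate_image hp hUC hCmaps (hAU ht)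
  have hback : ∀ m k, f^[m] (y (k + m)) = y k := by
    intro m k
    induction m with
    | zero => rfl
    | succ m ih => rw [Function.iterate_succ_apply, ← add_assoc, hy, ih]
  -- Since `r, s < p`, this satisfies `0 < m < 2 * p`; moving forward `m` steps from index `2 * p`
  -- leads from piece `s` into piece `r`, whose closure contains `t`.
  set m := r + p - s with hm
  have hmaps : MapsTo f^[m] (f^[s] '' C) (f^[r] '' C) := by
    rintro _ ⟨z, hz, rfl⟩
    refine ⟨f^[p] z, hCmaps hz, ?_⟩
    rw [← Function.iterate_add_apply, ← Function.iterate_add_apply,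
      show m + s = r + p by omega]
  have hyr : y (2 * p - m) ∈ closure (f^[r] '' C) := by
    have := hmaps.closure (hcont.iterate m) hys
    rwa [show 2 * p = (2 * p - m) + m by omega, hback] at this
  refine ⟨2 * p - m, (dist_le_of_mem_closure (hC.image _ (hcont.iterate r).continuousOn) ?_ hlong
    htr hyr).trans_lt (half_lt_self hη)⟩
  rintro _ ⟨z, hz, rfl⟩
  exact mapsTo_forwardUnion.iterate r (hCU hz)

theorem IsTame.exists_dense_backward (hf : IsTame f a b c) (hA : IsAttractor f a b A)
    (huniq : ∀ B, IsAttractor f a b B → B = A) {x : ℝ} (hx : x ∈ A) :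
    ∃ y : ℕ → ℝ, y 0 = x ∧ (∀ n, y n ∈ Icc a b) ∧ (∀ n, f (y (n + 1)) = y n) ∧
      A ⊆ closure (range y) := by
  have hdense : ∀ V, IsOpen V → V.Nonempty → V ⊆ Icc a b → A ⊆ closure (forwardUnion f V) :=
    fun V hV hne hab =>
      subset_closure_forwardUnion_of_unique hf.isFold.continuous hf.mapsTo huniq hV hne hab
  by_cases h : ∃ V, IsOpen V ∧ V.Nonempty ∧ V ⊆ Icc a b ∧
      ∀ ε > 0, V ⊆ forwardUnion f (Metric.ball c ε)
  · obtain ⟨V, hV, hne, hab, hball⟩ := h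
    obtain ⟨y, h0, hmem, hstep, hcl⟩ :=
      (hf.isTransitiveOn_closure_forwardUnion hA.basin_pos hdense hV hab
        hball).exists_dense_backward hf.isFold (hdense V hV hne hab hx)
    exact ⟨y, h0, fun n => closure_forwardUnion_subset_Icc hf.mapsTo hab (hmem n), hstep,
      (hdense V hV hne hab).trans hcl⟩
  · push Not at h
    obtain ⟨y, h0, hmem, hstep, hcl⟩ := hf.exists_dense_backward_of_small hA hdense h hx
    exact ⟨y, h0, fun n => hA.subset (hmem n), hstep, hcl⟩

end Tame

/-! ### Chaotic attractors -/

theorem isTransitiveOn_of_dense_orbit {f : ℝ → ℝ} {A : Set ℝ} (hA : IsCompact A)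
    (hmaps : MapsTo f A A) (hint : A ⊆ closure (interior A)) {z : ℝ}
    (hz : A ⊆ closure (range fun n : ℕ => f^[n] z)) : IsTransitiveOn f A := by
  refine ⟨hA, hmaps, hint, fun V hV hne hVA t ht => mem_closure_iff.2 fun O hO htO => ?_⟩
  obtain ⟨v, hv⟩ := hne
  obtain ⟨_, hmV, m, rfl⟩ := mem_closure_iff.1 (hz (hVA hv)) V hV hv
  obtain ⟨s, hsO, hs⟩ := mem_closure_iff.1 (hint ht) O hO htO
  have hfin : ((Finset.range m).image fun i => f^[i] z : Set ℝ).Finite :=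
    ((Finset.range m).image fun i => f^[i] z).finite_toSet
  -- Deleting the first `m` orbit points forces the visit to `O` to come no earlier than the visit
  -- to `V` at time `m`.
  have hopen : IsOpen ((O ∩ interior A) \ ((Finset.range m).image fun i => f^[i] z : Set ℝ)) :=
    (hO.inter isOpen_interior).sdiff hfin.isClosed
  have hinf : (O ∩ interior A).Infinite :=
    infinite_of_mem_nhds s ((hO.inter isOpen_interior).mem_nhds ⟨hsO, hs⟩)
  obtain ⟨w, hw⟩ := (hinf.sdiff hfin).nonempty
  obtain ⟨_, hnO, n, rfl⟩ := mem_closure_iff.1 (hz (interior_subset hw.1.2)) _ hopen hw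
  have hmn : m ≤ n := by
    by_contra! hnm
    exact hnO.2 (by simpa using ⟨n, hnm, rfl⟩)
  refine ⟨_, hnO.1.1, mem_forwardUnion.2 ⟨n - m, _, hmV, ?_⟩⟩
  dsimp only
  rw [← Function.iterate_add_apply, Nat.sub_add_cancel hmn]

theorem IsChaotic.isTransitiveOn {f : ℝ → ℝ} {a b c : ℝ} {A : Set ℝ} (h : IsChaotic f a b c A)
    (hmaps : MapsTo f A A) : IsTransitiveOn f A := by
  obtain ⟨⟨k, l, r, htrap, rfl⟩, z, -, hz⟩ := h
  refine isTransitiveOn_of_dense_orbit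
    ((Finset.range k).isCompact_biUnion fun i _ => isCompact_Icc) hmaps ?_ hz
  refine iUnion₂_subset fun i hi => ?_
  rw [← closure_Ioo (htrap.lt i (Finset.mem_range.1 hi)).ne]
  refine closure_mono (interior_maximal (Ioo_subset_Icc_self.trans ?_) isOpen_Ioo)
  exact subset_biUnion_of_mem (u := fun i => Icc (l i) (r i)) (Finset.mem_coe.2 hi)

/-! ### Extension of a unimodal map to the line -/

section Extension

variable {f g : ℝ → ℝ} {a b c : ℝ}

theorem IsFold.neg (h : IsFold f c) : IsFold (-f) c :=
  ⟨h.continuous.neg, fun _ hx _ hy hxy => h.injOn_Iic hx hy (neg_injective hxy),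
    fun _ hx _ hy hxy => h.injOn_Ici hx hy (neg_injective hxy)⟩

theorem exists_isFold_eqOn_of_mono_anti (hc : c ∈ Ioo a b) (hf : ContinuousOn f (Icc a b))
    (hmono : StrictMonoOn f (Icc a c)) (hanti : StrictAntiOn f (Icc c b)) :
    ∃ g, IsFold g c ∧ EqOn f g (Icc a b) := by
  have hab : a ≤ b := (hc.1.trans hc.2).le
  set P : ℝ → ℝ := fun x => max a (min b x) with hP
  have hPc : Continuous P := by fun_prop
  have hPmem : ∀ x, P x ∈ Icc a b := fun x => ⟨le_max_left _ _, max_le hab (min_le_left _ _)⟩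
  have hPid : ∀ x ∈ Icc a b, P x = x := fun x hx => by
    simp only [hP]
    rw [min_eq_right hx.2, max_eq_right hx.1]
  have hPlt : ∀ x < a, P x = a := fun x hx => by
    simp only [hP]
    rw [min_eq_right (hx.le.trans hab), max_eq_left hx.le]
  have hPgt : ∀ x > b, P x = b := fun x hx => by
    simp only [hP]
    rw [min_eq_left hx.le, max_eq_right hab]
  have ha : a ∈ Icc a c := left_mem_Icc.2 hc.1.le
  have hb : b ∈ Icc c b := right_mem_Icc.2 hc.2.le
  -- `P` is the retraction onto `[a,b]`; the penalty `|x - P x|` continues the two monotone branches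
  -- strictly outside it.
  refine ⟨fun x => f (P x) - |x - P x|, ⟨?_, ?_, ?_⟩, fun x hx => by simp [hPid x hx]⟩
  · exact (hf.comp_continuous hPc hPmem).sub (continuous_id.sub hPc).abs
  · refine StrictMonoOn.injOn fun x hx y hy hxy => ?_
    rcases lt_or_ge x a with hxa | hxa
    · rw [hPlt x hxa, abs_of_neg (sub_neg.2 hxa)]
      rcases lt_or_ge y a with hya | hya
      · rw [hPlt y hya, abs_of_neg (sub_neg.2 hya)]
        linarith
      · rw [hPid y ⟨hya, (mem_Iic.1 hy).trans hc.2.le⟩, sub_self, abs_zero]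
        have := hmono.monotoneOn ha ⟨hya, hy⟩ hya
        linarith
    · have hya := hxa.trans hxy.le
      rw [hPid x ⟨hxa, (mem_Iic.1 hx).trans hc.2.le⟩, hPid y ⟨hya, (mem_Iic.1 hy).trans hc.2.le⟩]
      simpa using hmono ⟨hxa, hx⟩ ⟨hya, hy⟩ hxy
  · refine StrictAntiOn.injOn fun x hx y hy hxy => ?_
    rcases lt_or_ge b y with hyb | hyb
    · rw [hPgt y hyb, abs_of_pos (sub_pos.2 hyb)]
      rcases lt_or_ge b x with hxb | hxb
      · rw [hPgt x hxb, abs_of_pos (sub_pos.2 hxb)]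
        linarith
      · rw [hPid x ⟨hc.1.le.trans hx, hxb⟩, sub_self, abs_zero]
        have := hanti.antitoneOn ⟨hx, hxb⟩ hb hxb
        linarith
    · have hxb := hxy.le.trans hyb
      rw [hPid x ⟨hc.1.le.trans hx, hxb⟩, hPid y ⟨hc.1.le.trans hy, hyb⟩]
      simpa using hanti ⟨hx, hxb⟩ ⟨hy, hyb⟩ hxy

theorem IsUnimodal.exists_isFold_eqOn (hf : IsUnimodal f a b c) :
    ∃ g, IsFold g c ∧ EqOn f g (Icc a b) := by
  rcases hf.monotone with ⟨h1, h2⟩ | ⟨h1, h2⟩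
  · exact exists_isFold_eqOn_of_mono_anti hf.mem hf.continuousOn h1 h2
  · obtain ⟨g, hg, hfg⟩ := exists_isFold_eqOn_of_mono_anti (f := -f) hf.mem hf.continuousOn.neg
      (fun x hx y hy hxy => neg_lt_neg (h1 hx hy hxy)) (fun x hx y hy hxy => neg_lt_neg (h2 hx hy hxy))
    refine ⟨-g, hg.neg, fun x hx => ?_⟩
    rw [Pi.neg_apply, ← hfg hx, Pi.neg_apply, neg_neg]

theorem iterate_eq_of_eqOn {S : Set ℝ} (hfg : EqOn f g S) (hf : MapsTo f S S) (n : ℕ) {x : ℝ}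
    (hx : x ∈ S) : f^[n] x = g^[n] x := by
  induction n with
  | zero => rfl
  | succ n ih =>
    rw [Function.iterate_succ_apply', Function.iterate_succ_apply', ← ih, hfg (hf.iterate n hx)]

theorem basin_congr (hfg : EqOn f g (Icc a b)) (hf : MapsTo f (Icc a b) (Icc a b)) (A : Set ℝ) :
    basin f a b A = basin g a b A := by
  ext x
  refine and_congr_right fun hx => ?_
  have : (fun n : ℕ => f^[n] x) = fun n => g^[n] x :=
    funext fun n => iterate_eq_of_eqOn hfg hf n hx
  rw [omega, omega, this]

theorem IsAttractor.congr (hfg : EqOn f g (Icc a b)) (hf : MapsTo f (Icc a b) (Icc a b))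
    {A : Set ℝ} (hA : IsAttractor f a b A) : IsAttractor g a b A := by
  refine ⟨hA.isClosed, hA.subset, hA.invariant.congr (hfg.mono hA.subset),
    basin_congr hfg hf A ▸ hA.basin_pos, fun A' hA' hcl hinv => ?_⟩
  rw [← basin_congr hfg hf, ← basin_congr hfg hf]
  exact hA.minimal A' hA' hcl (hinv.congr (hfg.symm.mono (hA'.1.trans hA.subset)))

theorem IsCycle.congr (hfg : EqOn f g (Icc a b)) (hf : MapsTo f (Icc a b) (Icc a b)) {P : Set ℝ}
    (hP : IsCycle f a b P) : IsCycle g a b P := by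
  obtain ⟨q, hq, M, hM, hqM, rfl⟩ := hP
  refine ⟨q, hq, M, hM, (iterate_eq_of_eqOn hfg hf M hq).symm.trans hqM, ?_⟩
  exact congrArg range (funext fun n => iterate_eq_of_eqOn hfg hf n hq)

theorem IsTUnimodal.volume_basin_eq_zero (hf : IsTUnimodal f a b c) {P : Set ℝ}
    (hP : IsCycle f a b P) : volume (basin f a b P) = 0 := by
  by_contra h
  exact hf.no_attracting_cycle P ⟨hP, hP.isAttractor hf.unimodal.mapsTo (pos_iff_ne_zero.2 h)⟩

/-- Were all images disjoint, the absence of wandering intervals would put the interval in the basin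
of a cycle, which is null. -/
theorem IsTUnimodal.exists_inter (hf : IsTUnimodal f a b c) {l r : ℝ} (hlr : l < r)
    (hab : Icc l r ⊆ Icc a b) :
    ∃ i j : ℕ, i < j ∧ (f^[i] '' Icc l r ∩ f^[j] '' Icc l r).Nonempty := by
  by_contra! h
  refine hf.no_wandering l r ⟨hlr, hab, fun i j hij => ?_, ?_⟩
  · rcases hij.lt_or_gt with hij | hij
    · exact disjoint_iff_inter_eq_empty.2 (h i j hij)
    · exact (disjoint_iff_inter_eq_empty.2 (h j i hij)).symm
  · rintro ⟨P, hP, hsub⟩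
    exact (isOpen_Ioo.measure_pos volume (nonempty_Ioo.2 hlr)).ne' (measure_mono_null
      (Ioo_subset_Icc_self.trans hsub) (hf.volume_basin_eq_zero hP))

theorem IsTUnimodal.isTame (hf : IsTUnimodal f a b c) (hg : IsFold g c)
    (hfg : EqOn f g (Icc a b)) : IsTame g a b c := by
  have hmaps := hf.unimodal.mapsTo
  have hmaps' : MapsTo g (Icc a b) (Icc a b) := hmaps.congr hfg
  refine ⟨hg, hf.unimodal.mem, hmaps', fun l r hlr hab => ?_, fun P hP => ?_⟩
  · obtain ⟨i, j, hij, h⟩ := hf.exists_inter hlr hab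
    have himg : ∀ n, f^[n] '' Icc l r = g^[n] '' Icc l r := fun n =>
      image_congr fun x hx => iterate_eq_of_eqOn hfg hmaps n (hab hx)
    exact ⟨i, j, hij, himg i ▸ himg j ▸ h⟩
  · rw [← basin_congr hfg hmaps]
    exact hf.volume_basin_eq_zero (hP.congr hfg.symm hmaps')

theorem isBackwardOrbit_of_eqOn (hfg : EqOn f g (Icc a b)) {x : ℝ} {y : ℕ → ℝ} (h0 : y 0 = x)
    (hmem : ∀ n, y n ∈ Icc a b) (hstep : ∀ n, g (y (n + 1)) = y n) : IsBackwardOrbit f a b x y :=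
  ⟨h0, hmem, fun n => (hfg (hmem _)).trans (hstep n)⟩

theorem IsChaotic.congr (hfg : EqOn f g (Icc a b)) (hf : MapsTo f (Icc a b) (Icc a b)) {A : Set ℝ}
    (hA : IsChaotic f a b c A) : IsChaotic g a b c A := by
  obtain ⟨⟨k, l, r, ⟨h1, h2, h3, h4, h5, h6⟩, rfl⟩, z, hz, hcl⟩ := hA
  refine ⟨⟨k, l, r, ⟨h1, h2, h3, h4, h5, fun i hi => (h6 i hi).congr (hfg.mono (h3 i hi))⟩, rfl⟩,
    z, hz, ?_⟩
  have hzab : z ∈ Icc a b := by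
    obtain ⟨i, hi, hzi⟩ := mem_iUnion₂.1 hz
    exact h3 i (Finset.mem_range.1 hi) hzi
  rwa [← show (fun n : ℕ => f^[n] z) = fun n => g^[n] z from
    funext fun n => iterate_eq_of_eqOn hfg hf n hzab]

end Extension

end IntervalDyn

/-! ### The main theorem -/

theorem mainTheorem3 (f : ℝ → ℝ) (a b c : ℝ) (hf : IntervalDyn.IsTUnimodal f a b c)
    (A : Set ℝ) (hA : IntervalDyn.IsAttractor f a b A) :
    ((∀ B : Set ℝ, IntervalDyn.IsAttractor f a b B → B = A) →
      ∀ x ∈ A, ∃ y : ℕ → ℝ, IntervalDyn.IsBackwardOrbit f a b x y ∧ A ⊆ closure (range y)) ∧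
    (IntervalDyn.IsChaotic f a b c A →
      ∀ x ∈ A, ∃ y : ℕ → ℝ, IntervalDyn.IsBackwardOrbit f a b x y ∧ (∀ n, y n ∈ A) ∧
        A ⊆ closure (range y)) := by
  obtain ⟨g, hg, hfg⟩ := hf.unimodal.exists_isFold_eqOn
  have hmaps := hf.unimodal.mapsTo
  have hA' := hA.congr hfg hmaps
  refine ⟨fun huniq x hx => ?_, fun hchaos x hx => ?_⟩
  · obtain ⟨y, h0, hmem, hstep, hcl⟩ := (hf.isTame hg hfg).exists_dense_backward hA'
      (fun B hB => huniq B (hB.congr hfg.symm (hmaps.congr hfg))) hx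
    exact ⟨y, IntervalDyn.isBackwardOrbit_of_eqOn hfg h0 hmem hstep, hcl⟩
  · obtain ⟨y, h0, hmem, hstep, hcl⟩ :=
      ((hchaos.congr hfg hmaps).isTransitiveOn hA'.invariant).exists_dense_backward hg hx
    exact ⟨y, IntervalDyn.isBackwardOrbit_of_eqOn hfg h0 (fun n => hA.subset (hmem n)) hstep,
      hmem, hcl⟩
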